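/- Let $N\ge 1$ and $k\ge 1$ be integers. A density on $\mathbb{R}^N$ is a measurable function $\rho:\mathbb{R}^N\to[0,1]$ with $0<\int_{\mathbb{R}^N}\rho\,dx<+\infty$. For a density $\rho$ and an integer $n\ge 0$ put $$\mu_n(\rho):=\inf_{S\in\mathcal S_{n+1}}\ \max_{u\in S\setminus\{0\}}\frac{\int_{\mathbb{R}^N}\rho|\nabla u|^2\,dx}{\int_{\mathbb{R}^N}\rho u^2\,dx},$$ where $\mathcal S_{n+1}$ is the family of all subspaces of dimension $n+1$ of $\{u\cdot 1_{\{\rho>0\}}: u\in C_c^\infty(\mathbb{R}^N)\}$ (functions that agree almost everywhere being identified, and $\nabla(u\cdot 1_{\{\rho>0\}})$ being understood as $\nabla u$ on $\{\rho>0\}$). Let $$\mu_k^*:=\sup\Big\{\Big(\int_{\mathbb{R}^N}\rho\,dx\Big)^{2/N}\mu_k(\rho)\ :\ \rho \text{ a density on } \mathbb{R}^N\Big\}.$$ For densities $\rho_1,\dots,\rho_j$, the eigenvalues $\mu_0(\overline\rho)\le\mu_1(\overline\rho)\le\dots$ of the collection $\overline\rho=\rho_1\sqcup\dots\sqcup\rho_j$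 are the numbers $\mu_n(\rho_i)$, $1\le i\le j$, $n\ge 0$, counted with multiplicity and listed in increasing order. Then $\mu_k^*$ is attained by a collection of at most $k$ densities. Precisely, there exist $j\in\mathbb{N}$ with $j\le k$, densities $\rho_1,\dots,\rho_j$ on $\mathbb{R}^N$ and $n_1,\dots,n_j\in\mathbb{N}$ with $n_1+\dots+n_j=k$ such that $$\sum_{i=1}^j\int_{\mathbb{R}^N}\rho_i\,dx=1,\qquad \mu_k(\rho_1\sqcup\dots\sqcup\rho_j)=\mu_k^*\qquad\text{and}\qquad \mu_k^*=\mu_{n_1}(\rho_1)=\dots=\mu_{n_j}(\rho_j).$$ -/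

import Mathlib

open MeasureTheory
open scoped ENNReal ContDiff

/-- A density on `ℝ^N`: a measurable function with values in `[0,1]` and with
`0 < ∫ ρ < ∞`. -/
structure IsDensity {N : ℕ} (ρ : EuclideanSpace ℝ (Fin N) → ℝ) : Prop where
  measurable : Measurable ρ
  mem_Icc : ∀ x, ρ x ∈ Set.Icc (0 : ℝ) 1
  integrable : Integrable ρ volume
  mass_pos : 0 < ∫ x, ρ x

/-- The space `C_c^∞(ℝ^N)` of smooth, compactly supported real functions. -/
def testSpace (N : ℕ) : Submodule ℝ (EuclideanSpace ℝ (Fin N) → ℝ) where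
  carrier := {u | ContDiff ℝ ∞ u ∧ HasCompactSupport u}
  zero_mem' := ⟨contDiff_const, HasCompactSupport.zero⟩
  add_mem' := fun ha hb => ⟨ha.1.add hb.1, ha.2.add hb.2⟩
  smul_mem' := fun c _ hu => ⟨contDiff_const.smul hu.1, hu.2.smul_left (f := fun _ => c)⟩

/-- `S` represents a subspace of dimension `d` of the space
`{u · 1_{ρ > 0} : u ∈ C_c^∞(ℝ^N)}`, whose elements are identified when they agree almost
everywhere: `S` is a `d`-dimensional space of test functions on which `u ↦ u · 1_{ρ > 0}` is
injective modulo null sets. Every `d`-dimensional subspace of that space is the image of such an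
`S`. The integral of `ρ |∇u|²` depends on the class of `u · 1_{ρ > 0}` only, since the gradient of
a smooth function vanishes at almost every point at which the function vanishes. -/
structure IsAdmissible {N : ℕ} (ρ : EuclideanSpace ℝ (Fin N) → ℝ) (d : ℕ)
    (S : Submodule ℝ (EuclideanSpace ℝ (Fin N) → ℝ)) : Prop where
  le_testSpace : S ≤ testSpace N
  finrank_eq : Module.finrank ℝ S = d
  injective : ∀ u ∈ S, Set.indicator {x | 0 < ρ x} u =ᵐ[volume] 0 → u = 0

/-- The Rayleigh quotient `∫ ρ |∇u|² / ∫ ρ u²`. -/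
noncomputable def rayleigh {N : ℕ} (ρ u : EuclideanSpace ℝ (Fin N) → ℝ) : ℝ :=
  (∫ x, ρ x * ‖gradient u x‖ ^ 2) / (∫ x, ρ x * u x ^ 2)

/-- The eigenvalue `μ_k(ρ)`: the infimum over the admissible spaces `S` of dimension `k + 1` of
the maximum over `u ∈ S \ {0}` of the Rayleigh quotient. -/
noncomputable def densityEigenvalue {N : ℕ} (ρ : EuclideanSpace ℝ (Fin N) → ℝ) (k : ℕ) : ℝ≥0∞ :=
  ⨅ (S : Submodule ℝ (EuclideanSpace ℝ (Fin N) → ℝ)) (_ : IsAdmissible ρ (k + 1) S),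
    ⨆ (u : EuclideanSpace ℝ (Fin N) → ℝ) (_ : u ∈ S ∧ u ≠ 0), ENNReal.ofReal (rayleigh ρ u)

/-- The value `μ_k^* = sup (∫ ρ)^(2/N) μ_k(ρ)` over all densities `ρ` on `ℝ^N`. -/
noncomputable def maxEigenvalue (N k : ℕ) : ℝ≥0∞ :=
  ⨆ (ρ : EuclideanSpace ℝ (Fin N) → ℝ) (_ : IsDensity ρ),
    ENNReal.ofReal ((∫ x, ρ x) ^ (2 / (N : ℝ))) * densityEigenvalue ρ k

/-- The eigenvalue `μ_k` of the collection `ρ_1 ⊔ … ⊔ ρ_j`: the entry of index `k`, counted from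
`0`, in the increasing list with multiplicity of all the numbers `μ_n(ρ_i)`; in other words the
least `t` such that at least `k + 1` pairs `(i, n)` satisfy `μ_n(ρ_i) ≤ t`. -/
noncomputable def collectionEigenvalue {N j : ℕ} (ρ : Fin j → EuclideanSpace ℝ (Fin N) → ℝ)
    (k : ℕ) : ℝ≥0∞ :=
  sInf {t | ((k + 1 : ℕ) : ℕ∞) ≤ Set.encard {p : Fin j × ℕ | densityEigenvalue (ρ p.1) p.2 ≤ t}}

/-! ### Quadratic forms of densities, their positive families, and homotheties. -/

section Forms

open Filter Topology

variable {N : ℕ}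

local notation "𝔼" => EuclideanSpace ℝ (Fin N)

/-! ### Test functions and their gradients -/

/-! The proof is a concentration-compactness argument. Write μ* for `maxEigenvalue N k`. Everything
is expressed through the form t∫ρu² − ∫ρ|∇u|²: up to the boundary case of equality, μ_n(ρ) < t means
that this form is positive definite on some space of n+1 test functions. In this language no
operator or Sobolev space is needed, and for fixed test functions the form is linear in ρ, so it
passes to weak limits of densities.

Upper bound by gluing (`mul_le_maxEigenvalue_of_collection`). If Σ n_i = k and μ_{n_i}(ρ_i) ≥ T for
all i, then (Σ∫ρ_i)^{2/N} T ≤ μ*. The ρ_i are damped by a squared multiplier decaying exponentially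
at a slow rate, translated far apart and added, which gives a single density. The positive index of
a sum of forms is at most the sum of the indices (`exists_hasPositiveFamily_of_sum`), and the slow
multiplier hardly changes the eigenvalues.

Compactness (`exists_collection_of_sequence`). Along a maximizing sequence of unit mass, extract
nonzero weak limits seen from mutually diverging centers. Compactly supported functions attached to
different centers eventually have disjoint supports, so positive families of the limits add up to a
positive family of the sequence (`eventually_hasPositiveFamily_of_profiles`). Since μ_0 = 0, each
limit contributes at least one dimension, so there are at most k of them, and together they have at
most k eigenvalues below μ*. When no further limit can be extracted, no mass is lost: a remainder
that vanishes locally would split into k+1 separated groups of balls and produce k+1 small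
eigenvalues (`exists_hasPositiveFamily_of_vanishing`).

The limits thus have total mass at least 1 and μ_{n_i} ≥ μ* with Σ n_i = k. Gluing forces mass
exactly 1. It also forces equality of the eigenvalues, since dilating a density with a larger one
would gain mass. Finally μ_0 = 0 < μ* gives n_i ≥ 1, hence j ≤ k. -/

theorem differentiable_of_mem_testSpace {u : 𝔼 → ℝ} (hu : u ∈ testSpace N) :
    Differentiable ℝ u :=
  hu.1.differentiable (by simp)

theorem continuous_gradient {u : 𝔼 → ℝ} (hu : u ∈ testSpace N) : Continuous (gradient u) :=
  (InnerProductSpace.toDual ℝ 𝔼).symm.continuous.comp (hu.1.continuous_fderiv (by simp))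

theorem gradient_eq_zero_of_notMem_tsupport {u : 𝔼 → ℝ} {x : 𝔼} (hx : x ∉ tsupport u) :
    gradient u x = 0 := by
  have h : fderiv ℝ u x = 0 := by
    by_contra h
    exact hx (support_fderiv_subset ℝ h)
  simp [gradient, h]

theorem gradient_sum_smul {ι : Type*} (s : Finset ι) (c : ι → ℝ) {f : ι → 𝔼 → ℝ}
    (hf : ∀ a ∈ s, f a ∈ testSpace N) (x : 𝔼) :
    gradient (∑ a ∈ s, c a • f a) x = ∑ a ∈ s, c a • gradient (f a) x := by
  have h : fderiv ℝ (∑ a ∈ s, c a • f a) x = ∑ a ∈ s, c a • fderiv ℝ (f a) x := by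
    rw [fderiv_sum fun a ha => ((differentiable_of_mem_testSpace (hf a ha)) x).const_smul (c a)]
    refine Finset.sum_congr rfl fun a ha => ?_
    rw [fderiv_const_smul ((differentiable_of_mem_testSpace (hf a ha)) x)]
  simp [gradient, h, map_sum]

theorem sum_smul_mem_testSpace {ι : Type*} (s : Finset ι) (c : ι → ℝ) {f : ι → 𝔼 → ℝ}
    (hf : ∀ a ∈ s, f a ∈ testSpace N) : ∑ a ∈ s, c a • f a ∈ testSpace N :=
  Submodule.sum_mem _ fun a ha => Submodule.smul_mem _ _ (hf a ha)

/-! ### The quadratic form attached to a density -/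

/-- The density of the form `t ∫ ρ u v - ∫ ρ ∇u ⬝ ∇v`. -/
noncomputable def lagrangian (t : ℝ) (u v : 𝔼 → ℝ) (x : 𝔼) : ℝ :=
  t * (u x * v x) - inner ℝ (gradient u x) (gradient v x)

/-- The bilinear form `t ∫ ρ u v - ∫ ρ ∇u ⬝ ∇v`. -/
noncomputable def energyForm (ρ : 𝔼 → ℝ) (t : ℝ) (u v : 𝔼 → ℝ) : ℝ :=
  ∫ x, ρ x * lagrangian t u v x

theorem continuous_lagrangian (t : ℝ) {u v : 𝔼 → ℝ} (hu : u ∈ testSpace N)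
    (hv : v ∈ testSpace N) : Continuous (lagrangian t u v) := by
  have h1 := hu.1.continuous
  have h2 := hv.1.continuous
  have h3 := continuous_gradient hu
  have h4 := continuous_gradient hv
  unfold lagrangian
  fun_prop

theorem lagrangian_eq_zero (t : ℝ) {u : 𝔼 → ℝ} (v : 𝔼 → ℝ) {x : 𝔼} (hx : x ∉ tsupport u) :
    lagrangian t u v x = 0 := by
  simp [lagrangian, gradient_eq_zero_of_notMem_tsupport hx, image_eq_zero_of_notMem_tsupport hx]

theorem lagrangian_comm (t : ℝ) (u v : 𝔼 → ℝ) (x : 𝔼) :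
    lagrangian t u v x = lagrangian t v u x := by
  simp only [lagrangian, real_inner_comm, mul_comm (u x)]

theorem energyForm_comm (ρ : 𝔼 → ℝ) (t : ℝ) (u v : 𝔼 → ℝ) :
    energyForm ρ t u v = energyForm ρ t v u := by
  simp only [energyForm, lagrangian_comm t u v]

theorem hasCompactSupport_lagrangian (t : ℝ) {u : 𝔼 → ℝ} (v : 𝔼 → ℝ) (hu : u ∈ testSpace N) :
    HasCompactSupport (lagrangian t u v) :=
  HasCompactSupport.intro hu.2 fun _ hx => lagrangian_eq_zero t v hx

theorem lagrangian_sum_smul {ι : Type*} (s : Finset ι) (t : ℝ) (c : ι → ℝ) {f : ι → 𝔼 → ℝ}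
    (hf : ∀ a ∈ s, f a ∈ testSpace N) (v : 𝔼 → ℝ) (x : 𝔼) :
    lagrangian t (∑ a ∈ s, c a • f a) v x = ∑ a ∈ s, c a * lagrangian t (f a) v x := by
  simp only [lagrangian, gradient_sum_smul s c hf, Finset.sum_apply, Pi.smul_apply, smul_eq_mul,
    sum_inner, real_inner_smul_left, Finset.sum_mul, Finset.mul_sum, mul_sub,
    Finset.sum_sub_distrib]
  congr 1
  exact Finset.sum_congr rfl fun a _ => by ring

theorem lagrangian_self (t : ℝ) (u : 𝔼 → ℝ) (x : 𝔼) :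
    lagrangian t u u x = t * u x ^ 2 - ‖gradient u x‖ ^ 2 := by
  rw [lagrangian, real_inner_self_eq_norm_sq, sq (u x)]

/-- A measurable function with values in `[0,1]`. -/
structure IsWeight (ρ : 𝔼 → ℝ) : Prop where
  measurable : Measurable ρ
  mem_Icc : ∀ x, ρ x ∈ Set.Icc (0 : ℝ) 1

theorem IsDensity.isWeight {ρ : 𝔼 → ℝ} (h : IsDensity ρ) : IsWeight ρ := ⟨h.1, h.2⟩

theorem IsWeight.integrable_mul {ρ g : 𝔼 → ℝ} (h : IsWeight ρ) (hg : Integrable g) :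
    Integrable fun x => ρ x * g x :=
  hg.bdd_mul (c := 1) h.measurable.aestronglyMeasurable <| ae_of_all _ fun x => by
    rw [Real.norm_of_nonneg (h.mem_Icc x).1]
    exact (h.mem_Icc x).2

theorem IsWeight.integrable_lagrangian {ρ : 𝔼 → ℝ} (h : IsWeight ρ) (t : ℝ) {u v : 𝔼 → ℝ}
    (hu : u ∈ testSpace N) (hv : v ∈ testSpace N) :
    Integrable fun x => ρ x * lagrangian t u v x :=
  h.integrable_mul <| (continuous_lagrangian t hu hv).integrable_of_hasCompactSupport
    (hasCompactSupport_lagrangian t v hu)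

theorem IsWeight.energyForm_sum_left {ρ : 𝔼 → ℝ} (h : IsWeight ρ) {ι : Type*} (s : Finset ι)
    (t : ℝ) (c : ι → ℝ) {f : ι → 𝔼 → ℝ} (hf : ∀ a ∈ s, f a ∈ testSpace N) {v : 𝔼 → ℝ}
    (hv : v ∈ testSpace N) :
    energyForm ρ t (∑ a ∈ s, c a • f a) v = ∑ a ∈ s, c a * energyForm ρ t (f a) v := by
  simp only [energyForm, lagrangian_sum_smul s t c hf, Finset.mul_sum]
  rw [integral_finsetSum]
  · refine Finset.sum_congr rfl fun a _ => ?_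
    rw [← integral_const_mul]
    exact integral_congr_ae (ae_of_all _ fun x => by ring)
  · intro a ha
    convert (h.integrable_lagrangian t (hf a ha) hv).const_mul (c a) using 2
    ring

theorem IsWeight.energyForm_sum {ρ : 𝔼 → ℝ} (h : IsWeight ρ) {ι : Type*} [Fintype ι]
    (t : ℝ) (c d : ι → ℝ) {f : ι → 𝔼 → ℝ} (hf : ∀ a, f a ∈ testSpace N) :
    energyForm ρ t (∑ a, c a • f a) (∑ a, d a • f a) =
      ∑ a, ∑ b, c a * d b * energyForm ρ t (f a) (f b) := by
  rw [h.energyForm_sum_left _ _ _ (fun a _ => hf a) (sum_smul_mem_testSpace _ _ fun a _ => hf a)]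
  refine Finset.sum_congr rfl fun a _ => ?_
  rw [energyForm_comm, h.energyForm_sum_left _ _ _ (fun a _ => hf a) (hf a), Finset.mul_sum]
  refine Finset.sum_congr rfl fun b _ => ?_
  rw [energyForm_comm]
  ring

theorem IsWeight.integrable_sq {ρ : 𝔼 → ℝ} (h : IsWeight ρ) {u : 𝔼 → ℝ} (hu : u ∈ testSpace N) :
    Integrable fun x => ρ x * u x ^ 2 := by
  refine h.integrable_mul ((hu.1.continuous.pow 2).integrable_of_hasCompactSupport ?_)
  exact HasCompactSupport.intro hu.2 fun x hx => by
    simp [image_eq_zero_of_notMem_tsupport hx]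

theorem IsWeight.integrable_gradient_sq {ρ : 𝔼 → ℝ} (h : IsWeight ρ) {u : 𝔼 → ℝ}
    (hu : u ∈ testSpace N) : Integrable fun x => ρ x * ‖gradient u x‖ ^ 2 := by
  refine h.integrable_mul
    (((continuous_gradient hu).norm.pow 2).integrable_of_hasCompactSupport ?_)
  exact HasCompactSupport.intro hu.2 fun x hx => by
    simp [gradient_eq_zero_of_notMem_tsupport hx]

theorem IsWeight.energyForm_self {ρ : 𝔼 → ℝ} (h : IsWeight ρ) (t : ℝ) {u : 𝔼 → ℝ}
    (hu : u ∈ testSpace N) :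
    energyForm ρ t u u = t * (∫ x, ρ x * u x ^ 2) - ∫ x, ρ x * ‖gradient u x‖ ^ 2 := by
  rw [energyForm, ← integral_const_mul, ← integral_sub ((h.integrable_sq hu).const_mul t)
    (h.integrable_gradient_sq hu)]
  exact integral_congr_ae (ae_of_all _ fun x => by simp only [lagrangian_self]; ring)

theorem IsWeight.integral_sq_nonneg {ρ : 𝔼 → ℝ} (h : IsWeight ρ) (u : 𝔼 → ℝ) :
    0 ≤ ∫ x, ρ x * u x ^ 2 :=
  integral_nonneg fun x => mul_nonneg (h.mem_Icc x).1 (sq_nonneg _)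

theorem IsWeight.integral_gradient_sq_nonneg {ρ : 𝔼 → ℝ} (h : IsWeight ρ) (u : 𝔼 → ℝ) :
    0 ≤ ∫ x, ρ x * ‖gradient u x‖ ^ 2 :=
  integral_nonneg fun x => mul_nonneg (h.mem_Icc x).1 (sq_nonneg _)

/-! ### Families on which the form is positive -/

/-- The form `t ∫ ρ u² - ∫ ρ |∇u|²` is positive definite on the combinations of some family of `m`
test functions. -/
def HasPositiveFamily (ρ : 𝔼 → ℝ) (t : ℝ) (m : ℕ) : Prop :=
  ∃ f : Fin m → 𝔼 → ℝ, (∀ a, f a ∈ testSpace N) ∧ ∀ c : Fin m → ℝ, c ≠ 0 →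
    0 < energyForm ρ t (∑ a, c a • f a) (∑ a, c a • f a)

theorem HasPositiveFamily.of_fintype {ρ : 𝔼 → ℝ} {t : ℝ} {ι : Type*} [Fintype ι] {m : ℕ}
    (hm : Fintype.card ι = m) {f : ι → 𝔼 → ℝ} (hf : ∀ a, f a ∈ testSpace N)
    (hpos : ∀ c : ι → ℝ, c ≠ 0 → 0 < energyForm ρ t (∑ a, c a • f a) (∑ a, c a • f a)) :
    HasPositiveFamily ρ t m := by
  obtain e := Fintype.equivFinOfCardEq hm
  refine ⟨fun a => f (e.symm a), fun a => hf _, fun c hc => ?_⟩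
  have hs : ∑ a, c a • f (e.symm a) = ∑ a, c (e a) • f a :=
    (Fintype.sum_equiv e _ _ fun a => by simp).symm
  rw [hs]
  refine hpos (fun a => c (e a)) fun h => hc ?_
  ext a
  simpa using congrFun h (e.symm a)

theorem HasPositiveFamily.mono_index {ρ : 𝔼 → ℝ} {t : ℝ} {m m' : ℕ} (hm : m' ≤ m)
    (h : HasPositiveFamily ρ t m) : HasPositiveFamily ρ t m' := by
  obtain ⟨f, hf, hpos⟩ := h
  refine ⟨fun a => f (Fin.castLE hm a), fun a => hf _, fun c hc => ?_⟩
  let d : Fin m → ℝ := fun a => if h : a.1 < m' then c ⟨a, h⟩ else 0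
  have hd : ∀ a, d (Fin.castLE hm a) = c a := fun a => by simp [d]
  have hs : ∑ a, d a • f a = ∑ a, c a • f (Fin.castLE hm a) := by
    symm
    rw [← Finset.sum_subset (Finset.subset_univ (Finset.univ.map (Fin.castLEEmb hm)))]
    · rw [Finset.sum_map]
      exact Finset.sum_congr rfl fun a _ => by
        rw [← hd a]; rfl
    · intro a _ ha
      have : ¬ a.1 < m' := fun h' => ha (by
        rw [Finset.mem_map]
        exact ⟨⟨a, h'⟩, Finset.mem_univ _, rfl⟩)
      simp [d, this]
  rw [← hs]
  refine hpos d fun h => hc ?_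
  ext a
  rw [← hd a, h]
  rfl

/-- Positivity of the form forces ∫ρu² > 0 on nonzero combinations, which gives both linear
independence and injectivity modulo null sets on {ρ > 0}. With the next lemma this replaces the
min-max definition by a count of positive directions; the two differ only at equality. -/
theorem densityEigenvalue_le_of_hasPositiveFamily {ρ : 𝔼 → ℝ} (hρ : IsWeight ρ) {t : ℝ} {n : ℕ}
    (h : HasPositiveFamily ρ t (n + 1)) : densityEigenvalue ρ n ≤ ENNReal.ofReal t := by
  obtain ⟨f, hf, hpos⟩ := h
  let L : (Fin (n + 1) → ℝ) →ₗ[ℝ] (𝔼 → ℝ) := Fintype.linearCombination ℝ f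
  have hL : ∀ c, L c = ∑ a, c a • f a := fun c => Fintype.linearCombination_apply ℝ f c
  have hLt : ∀ c, L c ∈ testSpace N := fun c => by
    rw [hL]
    exact sum_smul_mem_testSpace Finset.univ c fun a _ => hf a
  have hLp : ∀ c, c ≠ 0 →
      ∫ x, ρ x * ‖gradient (L c) x‖ ^ 2 < t * ∫ x, ρ x * L c x ^ 2 := fun c hc => by
    have := hpos c hc
    rw [← hL, hρ.energyForm_self _ (hLt c)] at this
    linarith
  have hsq : ∀ c, c ≠ 0 → 0 < ∫ x, ρ x * L c x ^ 2 := fun c hc => by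
    refine (hρ.integral_sq_nonneg (L c)).lt_of_ne fun h0 => ?_
    have := hLp c hc
    rw [← h0, mul_zero] at this
    exact absurd this (not_lt.2 (hρ.integral_gradient_sq_nonneg _))
  have hinj : Function.Injective L := by
    rw [← LinearMap.ker_eq_bot, LinearMap.ker_eq_bot']
    intro c hc
    by_contra hne
    have := hsq c hne
    simp [hc] at this
  have hadm : IsAdmissible ρ (n + 1) (LinearMap.range L) := by
    refine ⟨?_, ?_, ?_⟩
    · rintro _ ⟨c, rfl⟩
      exact hLt c
    · rw [LinearMap.finrank_range_of_inj hinj]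
      simp
    · rintro _ ⟨c, rfl⟩ h0
      by_contra hne
      have hc : c ≠ 0 := fun h => hne (by simp [h])
      have := hsq c hc
      rw [integral_eq_zero_of_ae] at this
      · exact lt_irrefl _ this
      · filter_upwards [h0] with x hx
        by_cases hx' : 0 < ρ x
        · rw [Set.indicator_of_mem (by exact hx')] at hx
          simp only [hx, Pi.zero_apply]
          simp
        · have : ρ x = 0 := le_antisymm (not_lt.1 hx') (hρ.mem_Icc x).1
          simp [this]
  refine (iInf₂_le _ hadm).trans (iSup₂_le ?_)
  rintro _ ⟨⟨c, rfl⟩, hne⟩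
  have hc : c ≠ 0 := fun h => hne (by simp [h])
  apply ENNReal.ofReal_le_ofReal
  rw [rayleigh, div_le_iff₀ (hsq c hc)]
  exact (hLp c hc).le

theorem hasPositiveFamily_of_densityEigenvalue_lt {ρ : 𝔼 → ℝ} (hρ : IsWeight ρ) {t : ℝ} {n : ℕ}
    (h : densityEigenvalue ρ n < ENNReal.ofReal t) : HasPositiveFamily ρ t (n + 1) := by
  simp only [densityEigenvalue, iInf_lt_iff] at h
  obtain ⟨S, hS, hlt⟩ := h
  have : FiniteDimensional ℝ S := Module.finite_of_finrank_pos (by rw [hS.finrank_eq]; omega)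
  let b := Module.finBasisOfFinrankEq ℝ S hS.finrank_eq
  refine ⟨fun a => (b a : 𝔼 → ℝ), fun a => hS.le_testSpace (b a).2, fun c hc => ?_⟩
  set u : S := ∑ a, c a • b a with hu
  have hcoe : ∑ a, c a • (b a : 𝔼 → ℝ) = (u : 𝔼 → ℝ) := by
    simp [hu]
  have hu0 : (u : 𝔼 → ℝ) ≠ 0 := fun h0 => hc (by
    have h1 : u = 0 := Subtype.ext h0
    ext a
    exact (Fintype.linearIndependent_iff.1 b.linearIndependent c (hu.symm.trans h1)) a)
  have hut : (u : 𝔼 → ℝ) ∈ testSpace N := hS.le_testSpace u.2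
  rw [hcoe, hρ.energyForm_self _ hut]
  have hsq : 0 < ∫ x, ρ x * (u : 𝔼 → ℝ) x ^ 2 := by
    refine (hρ.integral_sq_nonneg _).lt_of_ne fun h0 => hu0 (hS.injective _ u.2 ?_)
    have := (integral_eq_zero_iff_of_nonneg
      (fun x => mul_nonneg (hρ.mem_Icc x).1 (sq_nonneg _)) (hρ.integrable_sq hut)).1 h0.symm
    filter_upwards [this] with x hx
    by_cases hx' : 0 < ρ x
    · rw [Set.indicator_of_mem (by exact hx')]
      simpa [hx'.ne'] using hx
    · rw [Set.indicator_of_notMem (by exact hx')]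
      rfl
  have hR : rayleigh ρ u < t := by
    have := (le_iSup₂ (f := fun (v : 𝔼 → ℝ) (_ : v ∈ S ∧ v ≠ 0) => ENNReal.ofReal (rayleigh ρ v))
      (u : 𝔼 → ℝ) ⟨u.2, hu0⟩).trans_lt hlt
    exact (ENNReal.ofReal_lt_ofReal_iff_of_nonneg
      (div_nonneg (hρ.integral_gradient_sq_nonneg _) hsq.le)).1 this
  rw [rayleigh, div_lt_iff₀ hsq] at hR
  linarith

/-- Restricts comparisons in `ℝ≥0∞` to real levels t, the only ones at which the form is defined. -/
theorem densityEigenvalue_le_of_forall {ρ : 𝔼 → ℝ} {n : ℕ} {x : ℝ≥0∞}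
    (h : ∀ t : ℝ, x < ENNReal.ofReal t → densityEigenvalue ρ n ≤ ENNReal.ofReal t) :
    densityEigenvalue ρ n ≤ x := by
  refine le_of_forall_gt_imp_ge_of_dense fun y hy => ?_
  rcases eq_or_ne y ∞ with rfl | hy'
  · exact le_top
  · simpa [hy'] using h y.toReal (by simpa [hy'] using hy)

theorem densityEigenvalue_mono {ρ : 𝔼 → ℝ} (hρ : IsWeight ρ) :
    Monotone (densityEigenvalue ρ) := fun _ _ hmn =>
  densityEigenvalue_le_of_forall fun _ ht => densityEigenvalue_le_of_hasPositiveFamily hρ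
    ((hasPositiveFamily_of_densityEigenvalue_lt hρ ht).mono_index (by omega))

/-! ### Homotheties and translations -/

theorem integral_comp_smul_add {a : ℝ} (ha : 0 < a) (b : 𝔼) (g : 𝔼 → ℝ) :
    ∫ x, g (a • x + b) = (a ^ N)⁻¹ * ∫ x, g x := by
  rw [Measure.integral_comp_smul volume (fun x => g (x + b)) a, integral_add_right_eq_self]
  simp [abs_of_pos ha]

theorem gradient_comp_smul_add {u : 𝔼 → ℝ} (hu : Differentiable ℝ u) (a : ℝ) (b x : 𝔼) :
    gradient (fun y => u (a • y + b)) x = a • gradient u (a • x + b) := by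
  have h : HasFDerivAt (fun y : 𝔼 => a • y + b) (a • ContinuousLinearMap.id ℝ 𝔼) x :=
    ((hasFDerivAt_id x).const_smul a).add_const b
  have h2 := ((hu (a • x + b)).hasFDerivAt.comp x h).fderiv
  have h3 : fderiv ℝ (fun y => u (a • y + b)) x = a • fderiv ℝ u (a • x + b) := by
    rw [show (fun y => u (a • y + b)) = u ∘ fun y : 𝔼 => a • y + b from rfl, h2]
    ext y
    simp
  simp [gradient, h3]

theorem comp_smul_add_mem_testSpace {u : 𝔼 → ℝ} (hu : u ∈ testSpace N) {a : ℝ} (ha : 0 < a)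
    (b : 𝔼) : (fun y => u (a • y + b)) ∈ testSpace N := by
  refine ⟨hu.1.comp (by fun_prop), ?_⟩
  let e : 𝔼 ≃ₜ 𝔼 := (Homeomorph.smulOfNeZero a ha.ne').trans (Homeomorph.addRight b)
  exact hu.2.comp_homeomorph e

theorem IsWeight.comp_smul_add {ρ : 𝔼 → ℝ} (h : IsWeight ρ) (a : ℝ) (b : 𝔼) :
    IsWeight fun x => ρ (a • x + b) :=
  ⟨h.measurable.comp (by fun_prop), fun x => h.mem_Icc _⟩

theorem IsDensity.comp_smul_add {ρ : 𝔼 → ℝ} (h : IsDensity ρ) {a : ℝ} (ha : 0 < a) (b : 𝔼) :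
    IsDensity fun x => ρ (a • x + b) where
  measurable := h.measurable.comp (by fun_prop)
  mem_Icc x := h.mem_Icc _
  integrable := by
    have := (h.integrable.comp_add_right b).comp_smul ha.ne'
    exact this
  mass_pos := by
    rw [integral_comp_smul_add ha]
    have := h.mass_pos
    positivity

/-- The change of variables multiplies the form by a^(2-N). Pure translations are the case a = 1. -/
theorem HasPositiveFamily.comp_smul_add {ρ : 𝔼 → ℝ} {t : ℝ} {m : ℕ}
    (h : HasPositiveFamily ρ t m) {a : ℝ} (ha : 0 < a) (b : 𝔼) :
    HasPositiveFamily (fun x => ρ (a • x + b)) (a ^ 2 * t) m := by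
  obtain ⟨f, hf, hpos⟩ := h
  refine ⟨fun i y => f i (a • y + b), fun i => comp_smul_add_mem_testSpace (hf i) ha b,
    fun c hc => ?_⟩
  have hs : ∑ i, c i • (fun y => f i (a • y + b)) =
      fun y => (∑ i, c i • f i) (a • y + b) := by
    ext y
    simp
  have hL : ∀ x, ρ (a • x + b) * lagrangian (a ^ 2 * t) (∑ i, c i • (fun y => f i (a • y + b)))
      (∑ i, c i • (fun y => f i (a • y + b))) x =
      (fun y => a ^ 2 * (ρ y * lagrangian t (∑ i, c i • f i) (∑ i, c i • f i) y))
        (a • x + b) := fun x => by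
    rw [hs, lagrangian_self, gradient_comp_smul_add (differentiable_of_mem_testSpace
      (sum_smul_mem_testSpace _ _ fun i _ => hf i)), norm_smul, Real.norm_of_nonneg ha.le]
    simp only [lagrangian_self]
    ring
  rw [energyForm, integral_congr_ae (ae_of_all _ hL), integral_comp_smul_add ha b
    fun y => a ^ 2 * (ρ y * lagrangian t (∑ i, c i • f i) (∑ i, c i • f i) y),
    integral_const_mul]
  have := hpos c hc
  rw [energyForm] at this
  positivity

theorem densityEigenvalue_comp_smul_add_le {ρ : 𝔼 → ℝ} (hρ : IsWeight ρ) (n : ℕ) {a : ℝ}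
    (ha : 0 < a) (b : 𝔼) :
    densityEigenvalue (fun x => ρ (a • x + b)) n ≤
      ENNReal.ofReal (a ^ 2) * densityEigenvalue ρ n := by
  refine densityEigenvalue_le_of_forall fun t ht => ?_
  have ha2 : (0 : ℝ) < a ^ 2 := by positivity
  have h : densityEigenvalue ρ n < ENNReal.ofReal (t / a ^ 2) := by
    rw [ENNReal.ofReal_div_of_pos ha2]
    refine ENNReal.lt_div_iff_mul_lt (.inl (by simpa using ha.ne')) (.inl (by simp)) |>.2 ?_
    rwa [mul_comm]
  have h2 := (hasPositiveFamily_of_densityEigenvalue_lt hρ h).comp_smul_add ha b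
  rw [mul_div_cancel₀ _ ha2.ne'] at h2
  exact densityEigenvalue_le_of_hasPositiveFamily (hρ.comp_smul_add a b) h2

theorem densityEigenvalue_comp_smul_add {ρ : 𝔼 → ℝ} (hρ : IsWeight ρ) (n : ℕ) {a : ℝ}
    (ha : 0 < a) (b : 𝔼) :
    densityEigenvalue (fun x => ρ (a • x + b)) n =
      ENNReal.ofReal (a ^ 2) * densityEigenvalue ρ n := by
  refine (densityEigenvalue_comp_smul_add_le hρ n ha b).antisymm ?_
  -- The inverse homothety x ↦ a⁻¹(x − b) turns the inequality into an equality.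
  have h := densityEigenvalue_comp_smul_add_le (hρ.comp_smul_add a b) n (inv_pos.2 ha)
    (-(a⁻¹ • b))
  have hid : (fun x => ρ (a • (a⁻¹ • x + -(a⁻¹ • b)) + b)) = ρ := by
    ext x
    simp [smul_add, smul_smul, ha.ne']
  rw [hid] at h
  calc _ ≤ ENNReal.ofReal (a ^ 2) * (ENNReal.ofReal (a⁻¹ ^ 2) *
        densityEigenvalue (fun x => ρ (a • x + b)) n) := by gcongr
    _ = _ := by
      rw [← mul_assoc, ← ENNReal.ofReal_mul (by positivity), inv_pow,
        mul_inv_cancel₀ (by positivity)]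
      simp

end Forms

/-! ### Subadditivity of the positive index, and damping by a slowly decaying multiplier. -/

section Sums

open Filter Topology

/-! ### Indices of sums of quadratic forms -/

/-- Take W to be the orthogonal of a positive subspace P of greatest dimension: a vector w of W with
B w w > 0 could be added to P. The bound on dim W holds for degenerate B too. -/
theorem LinearMap.BilinForm.exists_nonpos_of_finrank_pos_le {V : Type*} [AddCommGroup V]
    [Module ℝ V] [FiniteDimensional ℝ V] {B : LinearMap.BilinForm ℝ V} (hB : B.IsSymm) (n : ℕ)
    (h : ∀ P : Submodule ℝ V, (∀ v ∈ P, v ≠ 0 → 0 < B v v) → Module.finrank ℝ P ≤ n) :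
    ∃ W : Submodule ℝ V, Module.finrank ℝ V ≤ Module.finrank ℝ W + n ∧ ∀ w ∈ W, B w w ≤ 0 := by
  classical
  let p : ℕ → Prop := fun d => ∃ P : Submodule ℝ V,
    (∀ v ∈ P, v ≠ 0 → 0 < B v v) ∧ Module.finrank ℝ P = d
  have hp0 : p 0 := ⟨⊥, fun v hv hv0 => absurd ((Submodule.mem_bot ℝ).1 hv) hv0, by simp⟩
  obtain ⟨P, hP, hPd⟩ : p (Nat.findGreatest p n) := Nat.findGreatest_spec (Nat.zero_le n) hp0
  have hmax : ∀ Q : Submodule ℝ V, (∀ v ∈ Q, v ≠ 0 → 0 < B v v) →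
      Module.finrank ℝ Q ≤ Module.finrank ℝ P := fun Q hQ => by
    rw [hPd]
    exact Nat.le_findGreatest (h Q hQ) ⟨Q, hQ, rfl⟩
  refine ⟨B.orthogonal P, ?_, fun w hw => ?_⟩
  · have h1 := LinearMap.BilinForm.finrank_add_finrank_orthogonal hB.isRefl P
    have h2 := h P hP
    omega
  · by_contra! hpos
    have horth : ∀ v ∈ P, B v w = 0 := fun v hv => hw v hv
    have hwP : w ∉ P := fun hwP => by
      have := horth w hwP
      linarith
    have hQ : ∀ v ∈ P ⊔ Submodule.span ℝ {w}, v ≠ 0 → 0 < B v v := by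
      intro v hv hv0
      obtain ⟨q, hq, z, hz, rfl⟩ := Submodule.mem_sup.1 hv
      obtain ⟨c, rfl⟩ := Submodule.mem_span_singleton.1 hz
      have hwq : B w q = 0 := by rw [hB.eq]; exact horth q hq
      have hexp : B (q + c • w) (q + c • w) = B q q + c ^ 2 * B w w := by
        simp only [map_add, map_smul, LinearMap.add_apply, LinearMap.smul_apply, smul_eq_mul,
          horth q hq, hwq]
        ring
      rw [hexp]
      by_cases hq0 : q = 0
      · have hc : c ≠ 0 := fun hc => hv0 (by simp [hq0, hc])
        have : 0 < c ^ 2 := by positivity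
        simp only [hq0, map_zero, zero_add]
        positivity
      · have := hP q hq hq0
        positivity
    have hlt : P < P ⊔ Submodule.span ℝ {w} := by
      refine lt_of_le_of_ne le_sup_left fun heq => hwP ?_
      rw [heq]
      exact Submodule.mem_sup_right (Submodule.mem_span_singleton_self w)
    exact absurd (hmax _ hQ) (not_le.2 (Submodule.finrank_lt_finrank_of_lt hlt))

theorem Submodule.finrank_le_finrank_iInf_add_sum {V : Type*} [AddCommGroup V] [Module ℝ V]
    [FiniteDimensional ℝ V] {ι : Type*} (s : Finset ι) (W : ι → Submodule ℝ V) (n : ι → ℕ)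
    (h : ∀ i, Module.finrank ℝ V ≤ Module.finrank ℝ (W i) + n i) :
    Module.finrank ℝ V ≤ Module.finrank ℝ (s.inf W : Submodule ℝ V) + ∑ i ∈ s, n i := by
  classical
  induction s using Finset.induction_on with
  | empty =>
    rw [Finset.inf_empty, finrank_top]
    exact Nat.le_add_right _ _
  | insert a s ha ih =>
    rw [Finset.inf_insert, Finset.sum_insert ha]
    have h1 := Submodule.finrank_sup_add_finrank_inf_eq (W a) (s.inf W)
    have h2 := Submodule.finrank_le (W a ⊔ s.inf W)
    have h3 := h a
    omega

variable {N : ℕ}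

local notation "𝔼" => EuclideanSpace ℝ (Fin N)

theorem energyForm_finset_sum {ι : Type*} (s : Finset ι) {ρ : ι → 𝔼 → ℝ}
    (hρ : ∀ i ∈ s, IsWeight (ρ i)) (t : ℝ) {u v : 𝔼 → ℝ} (hu : u ∈ testSpace N)
    (hv : v ∈ testSpace N) :
    energyForm (fun x => ∑ i ∈ s, ρ i x) t u v = ∑ i ∈ s, energyForm (ρ i) t u v := by
  simp only [energyForm, Finset.sum_mul]
  exact integral_finsetSum _ fun i hi => (hρ i hi).integrable_lagrangian t hu hv

/-- A sum of weights has at most as many eigenvalues below `t` as the weights have together. -/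
theorem exists_hasPositiveFamily_of_sum {j : ℕ} {ρ : Fin j → 𝔼 → ℝ} (hρ : ∀ i, IsWeight (ρ i))
    {t : ℝ} {n : Fin j → ℕ} {k : ℕ} (hk : ∑ i, n i = k)
    (h : HasPositiveFamily (fun x => ∑ i, ρ i x) t (k + 1)) :
    ∃ i, HasPositiveFamily (ρ i) t (n i + 1) := by
  by_contra! hno
  obtain ⟨f, hf, hpos⟩ := h
  let B : Fin j → LinearMap.BilinForm ℝ (Fin (k + 1) → ℝ) := fun i =>
    Matrix.toBilin' (Matrix.of fun a b => energyForm (ρ i) t (f a) (f b))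
  have hBapp : ∀ i c d, B i c d =
      energyForm (ρ i) t (∑ a, c a • f a) (∑ a, d a • f a) := fun i c d => by
    rw [(hρ i).energyForm_sum t c d hf, Matrix.toBilin'_apply]
    refine Finset.sum_congr rfl fun a _ => Finset.sum_congr rfl fun b _ => ?_
    simp only [Matrix.of_apply]
    ring
  have hsymm : ∀ i, (B i).IsSymm := fun i => ⟨fun c d => by
    rw [hBapp, hBapp, energyForm_comm]⟩
  have hW : ∀ i, ∃ W : Submodule ℝ (Fin (k + 1) → ℝ),
      Module.finrank ℝ (Fin (k + 1) → ℝ) ≤ Module.finrank ℝ W + n i ∧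
        ∀ w ∈ W, B i w w ≤ 0 := fun i => by
    refine LinearMap.BilinForm.exists_nonpos_of_finrank_pos_le (hsymm i) (n i) fun P hP => ?_
    by_contra! hlt
    let b := Module.finBasis ℝ P
    refine hno i (HasPositiveFamily.mono_index (m := Module.finrank ℝ P) hlt
      ⟨fun l => ∑ a, (b l : Fin (k + 1) → ℝ) a • f a,
        fun l => sum_smul_mem_testSpace _ _ fun a _ => hf a, fun c hc => ?_⟩)
    set v : P := ∑ l, c l • b l with hv
    have hv0 : (v : Fin (k + 1) → ℝ) ≠ 0 := fun h0 => hc (by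
      ext l
      exact (Fintype.linearIndependent_iff.1 b.linearIndependent c
        (hv.symm.trans (Subtype.ext h0))) l)
    have hs : ∑ l, c l • ∑ a, (b l : Fin (k + 1) → ℝ) a • f a =
        ∑ a, (v : Fin (k + 1) → ℝ) a • f a := by
      simp only [hv, Finset.smul_sum, smul_smul, AddSubmonoidClass.coe_finsetSum,
        Submodule.coe_smul, Finset.sum_apply, Pi.smul_apply, smul_eq_mul, Finset.sum_smul]
      rw [Finset.sum_comm]
    rw [hs, ← hBapp]
    exact hP v v.2 hv0
  -- Each form is nonpositive on a space of codimension at most n_i. These spaces meet in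
  -- codimension at most k inside dimension k+1, hence in a nonzero vector, where the sum of the
  -- forms cannot be positive.
  choose W hWd hWn using hW
  have hdim := Submodule.finrank_le_finrank_iInf_add_sum Finset.univ W n hWd
  have hne : (Finset.univ.inf W : Submodule ℝ (Fin (k + 1) → ℝ)) ≠ ⊥ := fun hbot => by
    rw [hbot, finrank_bot, Module.finrank_fin_fun] at hdim
    omega
  obtain ⟨c, hc, hc0⟩ := Submodule.exists_mem_ne_zero_of_ne_bot hne
  have := hpos c hc0
  rw [energyForm_finset_sum _ (fun i _ => hρ i) t
    (sum_smul_mem_testSpace _ _ fun a _ => hf a) (sum_smul_mem_testSpace _ _ fun a _ => hf a)]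
    at this
  refine absurd this (not_lt.2 (Finset.sum_nonpos fun i hi => ?_))
  rw [← hBapp]
  exact hWn i c ((Submodule.mem_finsetInf.1 hc) i hi)

/-! ### Exponentially decaying multipliers -/

/-- The multiplier `exp (-ε √(1 + |x|²))`. -/
noncomputable def expDecay (ε : ℝ) (x : 𝔼) : ℝ := Real.exp (-ε * √(1 + ‖x‖ ^ 2))

theorem expDecay_pos (ε : ℝ) (x : 𝔼) : 0 < expDecay ε x := Real.exp_pos _

theorem contDiff_expDecay (ε : ℝ) : ContDiff ℝ ∞ (expDecay ε : 𝔼 → ℝ) := by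
  refine Real.contDiff_exp.comp (contDiff_const.mul (ContDiff.sqrt ?_ fun x => by positivity))
  exact contDiff_const.add (contDiff_norm_sq ℝ)

theorem norm_fderiv_expDecay_le {ε : ℝ} (hε : 0 ≤ ε) (x : 𝔼) :
    ‖fderiv ℝ (expDecay ε) x‖ ≤ ε * expDecay ε x := by
  have h0 : (0 : ℝ) < 1 + ‖x‖ ^ 2 := by positivity
  have h1 : HasFDerivAt (fun y : 𝔼 => 1 + ‖y‖ ^ 2) (2 • innerSL ℝ x) x :=
    (hasStrictFDerivAt_norm_sq x).hasFDerivAt.const_add 1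
  have h2 := ((h1.sqrt h0.ne').const_mul (-ε)).exp
  have h3 : fderiv ℝ (expDecay ε) x = _ := h2.fderiv
  rw [h3]
  have h4 : ‖x‖ ≤ √(1 + ‖x‖ ^ 2) := Real.le_sqrt_of_sq_le (by linarith)
  have h5 : 0 < √(1 + ‖x‖ ^ 2) := Real.sqrt_pos.2 h0
  rw [norm_smul, norm_smul, norm_smul, Real.norm_of_nonneg (Real.exp_pos _).le, norm_neg,
    Real.norm_of_nonneg hε, Real.norm_of_nonneg (by positivity), two_nsmul]
  have h6 : ‖innerSL ℝ x + innerSL ℝ x‖ ≤ 2 * ‖x‖ := by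
    refine (norm_add_le _ _).trans ?_
    rw [innerSL_apply_norm]
    linarith
  have h7 : 1 / (2 * √(1 + ‖x‖ ^ 2)) * ‖innerSL ℝ x + innerSL ℝ x‖ ≤ 1 := by
    rw [div_mul_eq_mul_div, one_mul, div_le_one (by positivity)]
    linarith
  rw [mul_comm]
  exact mul_le_mul_of_nonneg_right (by nlinarith) (Real.exp_pos _).le

/-- With ψ the multiplier, |∇ψ| ≤ εψ, so |∇(ψu)|² ≤ ψ²(|∇u| + ε|u|)² ≤ (1+ε)ψ²(|∇u|² + εu²). The
level (1+ε)(t+ε) is the one at which the extra term in u² cancels. -/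
theorem lagrangian_expDecay_mul_ge {ε : ℝ} (hε : 0 < ε) (t : ℝ) {u : 𝔼 → ℝ}
    (hu : u ∈ testSpace N) (x : 𝔼) :
    (1 + ε) * (expDecay ε x ^ 2 * lagrangian t u u x) ≤
      lagrangian ((1 + ε) * (t + ε)) (expDecay ε * u) (expDecay ε * u) x := by
  have hg : gradient (expDecay ε * u) x =
      expDecay ε x • gradient u x + u x • gradient (expDecay ε) x := by
    have : fderiv ℝ (expDecay ε * u) x =
        expDecay ε x • fderiv ℝ u x + u x • fderiv ℝ (expDecay ε) x :=
      fderiv_mul (((contDiff_expDecay ε).differentiable (by simp)) x)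
        ((differentiable_of_mem_testSpace hu) x)
    simp [gradient, this]
  have hψ := expDecay_pos ε x
  have hn : ‖gradient (expDecay ε : 𝔼 → ℝ) x‖ ≤ ε * expDecay ε x := by
    simpa [gradient] using norm_fderiv_expDecay_le hε.le x
  have h1 : ‖gradient (expDecay ε * u) x‖ ≤
      expDecay ε x * (‖gradient u x‖ + ε * |u x|) := by
    rw [hg]
    refine (norm_add_le _ _).trans ?_
    rw [norm_smul, norm_smul, Real.norm_of_nonneg hψ.le, Real.norm_eq_abs]
    nlinarith [abs_nonneg (u x)]
  have h2 : ‖gradient (expDecay ε * u) x‖ ^ 2 ≤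
      expDecay ε x ^ 2 * (‖gradient u x‖ + ε * |u x|) ^ 2 := by
    rw [← mul_pow]
    exact pow_le_pow_left₀ (norm_nonneg _) h1 2
  have h3 : (‖gradient u x‖ + ε * |u x|) ^ 2 ≤
      (1 + ε) * ‖gradient u x‖ ^ 2 + (1 + ε) * ε * u x ^ 2 := by
    rw [← sq_abs (u x)]
    nlinarith [mul_nonneg hε.le (sq_nonneg (‖gradient u x‖ - |u x|))]
  rw [lagrangian_self, lagrangian_self, Pi.mul_apply]
  nlinarith [mul_le_mul_of_nonneg_left h3 (sq_nonneg (expDecay ε x))]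

theorem expDecay_mul_mem_testSpace (ε : ℝ) {u : 𝔼 → ℝ} (hu : u ∈ testSpace N) :
    expDecay ε * u ∈ testSpace N :=
  ⟨(contDiff_expDecay ε).mul hu.1, hu.2.mul_left⟩

theorem HasPositiveFamily.of_expDecay_sq_mul {ρ : 𝔼 → ℝ} (hρ : IsWeight ρ) {ε : ℝ} (hε : 0 < ε)
    (hρ' : IsWeight fun x => expDecay ε x ^ 2 * ρ x) {t : ℝ} {m : ℕ}
    (h : HasPositiveFamily (fun x => expDecay ε x ^ 2 * ρ x) t m) :
    HasPositiveFamily ρ ((1 + ε) * (t + ε)) m := by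
  obtain ⟨f, hf, hpos⟩ := h
  refine ⟨fun a => expDecay ε * f a, fun a => expDecay_mul_mem_testSpace ε (hf a),
    fun c hc => ?_⟩
  have hs : ∑ a, c a • (expDecay ε * f a) = expDecay ε * ∑ a, c a • f a := by
    rw [Finset.mul_sum]
    exact Finset.sum_congr rfl fun a _ => by rw [mul_smul_comm]
  have hu := sum_smul_mem_testSpace Finset.univ c fun a _ => hf a
  rw [hs]
  have h1 := hpos c hc
  set u := ∑ a, c a • f a
  have h2 : (1 + ε) * energyForm (fun x => expDecay ε x ^ 2 * ρ x) t u u ≤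
      energyForm ρ ((1 + ε) * (t + ε)) (expDecay ε * u) (expDecay ε * u) := by
    rw [energyForm, energyForm, ← integral_const_mul]
    refine integral_mono ((hρ'.integrable_lagrangian t hu hu).const_mul _)
      (hρ.integrable_lagrangian _ (expDecay_mul_mem_testSpace ε hu)
        (expDecay_mul_mem_testSpace ε hu)) fun x => ?_
    have := mul_le_mul_of_nonneg_left (lagrangian_expDecay_mul_ge hε t hu x) (hρ.mem_Icc x).1
    calc _ = ρ x * ((1 + ε) * (expDecay ε x ^ 2 * lagrangian t u u x)) := by ring
      _ ≤ _ := this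
  refine lt_of_lt_of_le ?_ h2
  positivity

end Sums

/-! ### Gluing a collection into a single density. -/

section Gluing

open Filter Topology

variable {N : ℕ}

local notation "𝔼" => EuclideanSpace ℝ (Fin N)

theorem expDecay_le_exp_neg {ε : ℝ} (hε : 0 ≤ ε) (x : 𝔼) : expDecay ε x ≤ Real.exp (-ε) := by
  refine Real.exp_le_exp.2 ?_
  have : 1 ≤ √(1 + ‖x‖ ^ 2) := Real.le_sqrt_of_sq_le (by nlinarith [sq_nonneg ‖x‖])
  nlinarith

theorem expDecay_le_exp_neg_norm {ε : ℝ} (hε : 0 ≤ ε) (x : 𝔼) :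
    expDecay ε x ≤ Real.exp (-(ε * ‖x‖)) := by
  refine Real.exp_le_exp.2 ?_
  have : ‖x‖ ≤ √(1 + ‖x‖ ^ 2) := Real.le_sqrt_of_sq_le (by linarith)
  nlinarith

theorem expDecay_le_one {ε : ℝ} (hε : 0 ≤ ε) (x : 𝔼) : expDecay ε x ≤ 1 :=
  (expDecay_le_exp_neg hε x).trans (by simpa using hε)

theorem IsWeight.expDecay_sq_mul {ρ : 𝔼 → ℝ} (hρ : IsWeight ρ) {ε : ℝ} (hε : 0 ≤ ε) :
    IsWeight fun x => expDecay ε x ^ 2 * ρ x where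
  measurable := ((contDiff_expDecay ε).continuous.measurable.pow_const 2).mul hρ.measurable
  mem_Icc x := ⟨mul_nonneg (sq_nonneg _) (hρ.mem_Icc x).1,
    mul_le_one₀ (pow_le_one₀ (expDecay_pos ε x).le (expDecay_le_one hε x)) (hρ.mem_Icc x).1
      (hρ.mem_Icc x).2⟩

/-- Far away translates of the squared multiplier add up to at most one. -/
theorem exists_sum_expDecay_sq_le_one (hN : 1 ≤ N) (j : ℕ) {ε : ℝ} (hε : 0 < ε) :
    ∃ y : Fin j → 𝔼, ∀ x, ∑ i, expDecay ε (x + y i) ^ 2 ≤ 1 := by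
  rcases Nat.eq_zero_or_pos j with rfl | hj
  · exact ⟨fun _ => 0, fun x => by simp⟩
  have he : Real.exp (-ε) < 1 := by simpa using hε
  have he0 := Real.exp_pos (-ε)
  -- At every point the translate with the nearest center is at most e^(-ε), since √(1+|x|²) ≥ 1.
  -- The room 1 − e^(-ε) that remains is shared equally among the others.
  set η : ℝ := (1 - Real.exp (-ε)) / j with hη
  have hj' : (0 : ℝ) < j := by exact_mod_cast hj
  have hη0 : 0 < η := div_pos (by linarith) hj'
  have hlim : Tendsto (fun L : ℝ => Real.exp (-(ε * L))) atTop (𝓝 0) :=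
    Real.tendsto_exp_neg_atTop_nhds_zero.comp (tendsto_id.const_mul_atTop hε)
  obtain ⟨L, hLη, hL0⟩ := ((hlim.eventually_lt_const hη0).and (eventually_gt_atTop 0)).exists
  let e : 𝔼 := EuclideanSpace.single ⟨0, hN⟩ 1
  have hen : ‖e‖ = 1 := by simp [e]
  refine ⟨fun i => ((2 * L) * (i : ℝ)) • e, fun x => ?_⟩
  set y : Fin j → 𝔼 := fun i => ((2 * L) * (i : ℝ)) • e with hy
  have hsep : ∀ i l, i ≠ l → 2 * L ≤ ‖(x + y i) - (x + y l)‖ := fun i l hil => by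
    have h1 : (x + y i) - (x + y l) = (2 * L * ((i : ℝ) - l)) • e := by
      simp only [hy, mul_sub, sub_smul]
      abel
    have h2 : (1 : ℝ) ≤ |(i : ℝ) - l| := by
      have : (1 : ℤ) ≤ |(i : ℤ) - l| := Int.one_le_abs (by
        rw [sub_ne_zero]
        exact fun h => hil (Fin.ext (by exact_mod_cast h)))
      exact_mod_cast this
    rw [h1, norm_smul, hen, mul_one, Real.norm_eq_abs, abs_mul, abs_of_pos (by positivity)]
    nlinarith
  have : Nonempty (Fin j) := ⟨⟨0, hj⟩⟩
  obtain ⟨i₀, -, hi₀⟩ := Finset.exists_min_image Finset.univ (fun i => ‖x + y i‖)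
    Finset.univ_nonempty
  have hfar : ∀ i, i ≠ i₀ → expDecay ε (x + y i) ^ 2 ≤ η := fun i hi => by
    have h1 := hsep i i₀ hi
    have h2 := norm_sub_le (x + y i) (x + y i₀)
    have h3 := hi₀ i (Finset.mem_univ _)
    have h4 : L ≤ ‖x + y i‖ := by linarith
    have h5 := expDecay_le_exp_neg_norm hε.le (x + y i)
    have h6 : Real.exp (-(ε * ‖x + y i‖)) ≤ Real.exp (-(ε * L)) :=
      Real.exp_le_exp.2 (by nlinarith)
    have h7 := expDecay_le_one hε.le (x + y i)
    have h8 := expDecay_pos ε (x + y i)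
    nlinarith
  rw [← Finset.add_sum_erase _ _ (Finset.mem_univ i₀)]
  have h1 : ∑ i ∈ Finset.univ.erase i₀, expDecay ε (x + y i) ^ 2 ≤
      ∑ i ∈ Finset.univ.erase i₀, η :=
    Finset.sum_le_sum fun i hi => hfar i (Finset.ne_of_mem_erase hi)
  have h2 : ∑ i ∈ Finset.univ.erase i₀, η ≤ j * η := by
    rw [Finset.sum_const, nsmul_eq_mul]
    refine mul_le_mul_of_nonneg_right ?_ hη0.le
    exact_mod_cast (Finset.card_erase_le.trans (by simp))
  have h3 : j * η = 1 - Real.exp (-ε) := by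
    rw [hη]
    field_simp
  have h4 := expDecay_le_exp_neg hε.le (x + y i₀)
  have h5 := expDecay_pos ε (x + y i₀)
  have h6 := expDecay_le_one hε.le (x + y i₀)
  nlinarith

theorem mul_densityEigenvalue_le_maxEigenvalue {ρ : 𝔼 → ℝ} (hρ : IsDensity ρ) (k : ℕ) :
    ENNReal.ofReal ((∫ x, ρ x) ^ (2 / (N : ℝ))) * densityEigenvalue ρ k ≤ maxEigenvalue N k :=
  le_iSup₂ (f := fun (ρ : 𝔼 → ℝ) (_ : IsDensity ρ) =>
    ENNReal.ofReal ((∫ x, ρ x) ^ (2 / (N : ℝ))) * densityEigenvalue ρ k) ρ hρ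

/-- The competitor for μ* is the sum of far translates of the damped densities. A positive family of
dimension k+1 for it at level t would give one of dimension n_i + 1 for some ρ_i at level
(1+ε)(t+ε), against `ht`. -/
theorem glue_expDecay (hN : 1 ≤ N) {j : ℕ} (hj : 0 < j) {ρ : Fin j → 𝔼 → ℝ}
    (hρ : ∀ i, IsDensity (ρ i)) {n : Fin j → ℕ} {k : ℕ} (hk : ∑ i, n i = k) {ε t : ℝ}
    (hε : 0 < ε)
    (ht : ∀ i, ENNReal.ofReal ((1 + ε) * (t + ε)) < densityEigenvalue (ρ i) (n i)) :
    ENNReal.ofReal ((∑ i, ∫ x, expDecay ε x ^ 2 * ρ i x) ^ (2 / (N : ℝ)) * t) ≤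
      maxEigenvalue N k := by
  obtain ⟨y, hy⟩ := exists_sum_expDecay_sq_le_one hN j hε
  have hw : ∀ i, IsWeight fun x => expDecay ε x ^ 2 * ρ i x := fun i =>
    (hρ i).isWeight.expDecay_sq_mul hε.le
  have hint : ∀ i, Integrable fun x => expDecay ε x ^ 2 * ρ i x := fun i =>
    (hρ i).integrable.mono' (hw i).measurable.aestronglyMeasurable <| ae_of_all _ fun x => by
      have h1 := expDecay_pos ε x
      have h2 := expDecay_le_one hε.le x
      rw [Real.norm_of_nonneg ((hw i).mem_Icc x).1]
      exact mul_le_of_le_one_left ((hρ i).mem_Icc x).1 (pow_le_one₀ h1.le h2)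
  have hposi : ∀ i, 0 < ∫ x, expDecay ε x ^ 2 * ρ i x := fun i => by
    rw [integral_pos_iff_support_of_nonneg (fun x => ((hw i).mem_Icc x).1) (hint i)]
    have h1 := (hρ i).mass_pos
    rw [integral_pos_iff_support_of_nonneg (fun x => ((hρ i).mem_Icc x).1) (hρ i).integrable]
      at h1
    refine h1.trans_le (measure_mono fun x hx => ?_)
    exact mul_ne_zero (pow_ne_zero 2 (expDecay_pos ε x).ne') hx
  let σ : Fin j → 𝔼 → ℝ := fun i x => expDecay ε ((1 : ℝ) • x + y i) ^ 2 *
    ρ i ((1 : ℝ) • x + y i)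
  have hσw : ∀ i, IsWeight (σ i) := fun i => (hw i).comp_smul_add 1 (y i)
  have hσint : ∀ i, Integrable (σ i) := fun i => by
    have := (hint i).comp_add_right (y i)
    simpa [σ] using this
  have hσmass : ∀ i, ∫ x, σ i x = ∫ x, expDecay ε x ^ 2 * ρ i x := fun i => by
    have := integral_comp_smul_add one_pos (y i) fun x => expDecay ε x ^ 2 * ρ i x
    simpa [σ] using this
  have hmass : ∫ x, ∑ i, σ i x = ∑ i, ∫ x, expDecay ε x ^ 2 * ρ i x := by
    rw [integral_finsetSum _ fun i _ => hσint i]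
    exact Finset.sum_congr rfl fun i _ => hσmass i
  have hdens : IsDensity fun x => ∑ i, σ i x := by
    refine ⟨Finset.measurable_sum _ fun i _ => (hσw i).measurable,
      fun x => ⟨Finset.sum_nonneg fun i _ => ((hσw i).mem_Icc x).1, ?_⟩,
      integrable_finsetSum _ fun i _ => hσint i, ?_⟩
    · refine le_trans (Finset.sum_le_sum fun i _ => ?_) (hy x)
      simp only [σ, one_smul]
      exact mul_le_of_le_one_right (sq_nonneg _) ((hρ i).mem_Icc _).2
    · rw [hmass]
      have : Nonempty (Fin j) := ⟨⟨0, hj⟩⟩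
      exact Finset.sum_pos (fun i _ => hposi i) Finset.univ_nonempty
  have heig : ENNReal.ofReal t ≤ densityEigenvalue (fun x => ∑ i, σ i x) k := by
    by_contra! hlt
    obtain ⟨i, hi⟩ := exists_hasPositiveFamily_of_sum hσw hk
      (hasPositiveFamily_of_densityEigenvalue_lt hdens.isWeight hlt)
    have h1 := hi.comp_smul_add one_pos (-(y i))
    have h2 : (fun x => σ i ((1 : ℝ) • x + -(y i))) = fun x => expDecay ε x ^ 2 * ρ i x := by
      ext x
      simp [σ]
    rw [h2, one_pow, one_mul] at h1
    have h3 := h1.of_expDecay_sq_mul (hρ i).isWeight hε (hw i)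
    exact absurd (densityEigenvalue_le_of_hasPositiveFamily (hρ i).isWeight h3) (not_le.2 (ht i))
  refine le_trans ?_ (mul_densityEigenvalue_le_maxEigenvalue hdens k)
  rw [hmass, ENNReal.ofReal_mul (Real.rpow_nonneg (Finset.sum_nonneg fun i _ => (hposi i).le) _)]
  gcongr

/-- Densities can be glued together: `μ_k^*` dominates the eigenvalues of collections. -/
theorem mul_le_maxEigenvalue_of_collection (hN : 1 ≤ N) {j : ℕ} (hj : 0 < j)
    {ρ : Fin j → 𝔼 → ℝ} (hρ : ∀ i, IsDensity (ρ i)) {n : Fin j → ℕ} {k : ℕ}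
    (hk : ∑ i, n i = k) {T : ℝ≥0∞} (hT : ∀ i, T ≤ densityEigenvalue (ρ i) (n i)) :
    ENNReal.ofReal ((∑ i, ∫ x, ρ i x) ^ (2 / (N : ℝ))) * T ≤ maxEigenvalue N k := by
  have key : ∀ s : ℝ, ENNReal.ofReal s < T →
      ENNReal.ofReal ((∑ i, ∫ x, ρ i x) ^ (2 / (N : ℝ)) * s) ≤ maxEigenvalue N k := by
    intro s hs
    have hmass : ∀ i, Tendsto (fun ε : ℝ => ∫ x, expDecay ε x ^ 2 * ρ i x) (𝓝[>] 0)
        (𝓝 (∫ x, ρ i x)) := fun i => by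
      refine tendsto_integral_filter_of_dominated_convergence (ρ i) ?_ ?_ (hρ i).integrable ?_
      · filter_upwards [self_mem_nhdsWithin] with ε hε
        exact ((hρ i).isWeight.expDecay_sq_mul (le_of_lt hε)).measurable.aestronglyMeasurable
      · filter_upwards [self_mem_nhdsWithin] with ε hε
        refine ae_of_all _ fun x => ?_
        have h1 := expDecay_pos ε x
        have h2 := expDecay_le_one (le_of_lt hε) x
        rw [Real.norm_of_nonneg (mul_nonneg (sq_nonneg _) ((hρ i).mem_Icc x).1)]
        exact mul_le_of_le_one_left ((hρ i).mem_Icc x).1 (pow_le_one₀ h1.le h2)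
      · refine ae_of_all _ fun x => ?_
        have hc : Continuous fun ε : ℝ => expDecay ε x ^ 2 * ρ i x := by
          unfold expDecay
          fun_prop
        have := (hc.tendsto 0).mono_left (nhdsWithin_le_nhds (s := Set.Ioi 0))
        simpa [expDecay] using this
    have hsum := tendsto_finsetSum Finset.univ fun i _ => hmass i
    have hrpow := hsum.rpow_const (p := 2 / (N : ℝ)) (.inr (by positivity))
    -- The level t = s/(1+ε) − ε solves (1+ε)(t+ε) = s.
    have ht : Tendsto (fun ε : ℝ => s / (1 + ε) - ε) (𝓝[>] 0) (𝓝 s) := by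
      have hc : ContinuousAt (fun ε : ℝ => s / (1 + ε) - ε) 0 := by
        refine ContinuousAt.sub (ContinuousAt.div ?_ ?_ ?_) ?_ <;> first | fun_prop | simp
      have := hc.tendsto.mono_left (nhdsWithin_le_nhds (s := Set.Ioi 0))
      simpa using this
    refine le_of_tendsto (ENNReal.tendsto_ofReal (hrpow.mul ht)) ?_
    filter_upwards [self_mem_nhdsWithin] with ε hε
    have hε' : (0 : ℝ) < ε := hε
    refine glue_expDecay hN hj hρ hk hε fun i => ?_
    rw [sub_add_cancel, mul_div_cancel₀ _ (by positivity)]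
    exact hs.trans_le (hT i)
  refine ENNReal.mul_le_of_forall_lt fun a ha b hb => ?_
  have h := key b.toReal (by rwa [ENNReal.ofReal_toReal hb.ne_top])
  rw [ENNReal.ofReal_mul' ENNReal.toReal_nonneg, ENNReal.ofReal_toReal hb.ne_top] at h
  exact (mul_le_mul_left ha.le b).trans h

end Gluing

/-! ### Weak compactness of densities and positive families of weak limits. -/

section WeakCompactness

open Filter Topology

variable {N : ℕ}

local notation "𝔼" => EuclideanSpace ℝ (Fin N)

/-- Convergence of a sequence of weights tested against `L²`. -/
def TendstoWeakly (ρ : ℕ → 𝔼 → ℝ) (σ : 𝔼 → ℝ) : Prop :=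
  ∀ g : 𝔼 → ℝ, MemLp g 2 volume →
    Tendsto (fun n => ∫ x, ρ n x * g x) atTop (𝓝 (∫ x, σ x * g x))

theorem TendstoWeakly.comp {ρ : ℕ → 𝔼 → ℝ} {σ : 𝔼 → ℝ} (h : TendstoWeakly ρ σ) {φ : ℕ → ℕ}
    (hφ : StrictMono φ) : TendstoWeakly (fun n => ρ (φ n)) σ :=
  fun g hg => (h g hg).comp hφ.tendsto_atTop

theorem TendstoWeakly.setIntegral {ρ : ℕ → 𝔼 → ℝ} {σ : 𝔼 → ℝ} (h : TendstoWeakly ρ σ)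
    {s : Set 𝔼} (hs : MeasurableSet s) (hs' : volume s < ⊤) :
    Tendsto (fun n => ∫ x in s, ρ n x) atTop (𝓝 (∫ x in s, σ x)) := by
  have h1 := h (s.indicator fun _ => 1) (memLp_indicator_const 2 hs 1 (.inr hs'.ne))
  have h2 : ∀ f : 𝔼 → ℝ, ∫ x, f x * s.indicator (fun _ => (1 : ℝ)) x = ∫ x in s, f x := by
    intro f
    rw [← integral_indicator hs]
    refine integral_congr_ae (ae_of_all _ fun x => ?_)
    by_cases hx : x ∈ s <;> simp [hx]
  simpa only [h2] using h1

theorem IsWeight.integrableOn {ρ : 𝔼 → ℝ} (hρ : IsWeight ρ) {s : Set 𝔼} (hs : volume s < ⊤) :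
    IntegrableOn ρ s := by
  refine IntegrableOn.of_bound hs hρ.measurable.aestronglyMeasurable 1 (ae_of_all _ fun x => ?_)
  rw [Real.norm_of_nonneg (hρ.mem_Icc x).1]
  exact (hρ.mem_Icc x).2

theorem IsDensity.memLp_two {ρ : 𝔼 → ℝ} (hρ : IsDensity ρ) : MemLp ρ 2 volume := by
  rw [memLp_two_iff_integrable_sq hρ.measurable.aestronglyMeasurable]
  refine (hρ.isWeight.integrable_mul hρ.integrable).congr (ae_of_all _ fun x => ?_)
  simp only [sq]

theorem exists_subseq_inner_tendsto {H : Type*} [NormedAddCommGroup H] [InnerProductSpace ℝ H]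
    [CompleteSpace H] [TopologicalSpace.SeparableSpace H] (F : ℕ → H) (hF : ∀ n, ‖F n‖ ≤ 1) :
    ∃ φ : ℕ → ℕ, StrictMono φ ∧ ∃ G : H, ∀ g,
      Tendsto (fun n => inner ℝ (F (φ n)) g) atTop (𝓝 (inner ℝ G g)) := by
  have hc := WeakDual.isSeqCompact_closedBall ℝ H (0 : StrongDual ℝ H) 1
  obtain ⟨ℓ, -, φ, hφ, hlim⟩ := hc
    (x := fun n => StrongDual.toWeakDual (InnerProductSpace.toDual ℝ H (F n))) (fun n => by
      simp only [Set.mem_preimage, Metric.mem_closedBall, dist_zero_right,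
        StrongDual.toStrongDual_toWeakDual, LinearIsometryEquiv.norm_map]
      exact hF n)
  refine ⟨φ, hφ, (InnerProductSpace.toDual ℝ H).symm (WeakDual.toStrongDual ℓ), fun g => ?_⟩
  have h := (tendsto_iff_forall_eval_tendsto_topDualPairing.1 hlim) g
  rw [InnerProductSpace.toDual_symm_apply]
  exact h

/-- Since ρ² ≤ ρ, unit mass bounds the L² norm by 1. The limit is integrable because its integrals
over balls are at most 1; mass may escape, so it can even be zero. -/
theorem exists_tendstoWeakly {ρ : ℕ → 𝔼 → ℝ} (hρ : ∀ n, IsDensity (ρ n))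
    (hm : ∀ n, ∫ x, ρ n x = 1) :
    ∃ φ : ℕ → ℕ, StrictMono φ ∧ ∃ σ : 𝔼 → ℝ, IsWeight σ ∧ Integrable σ ∧
      TendstoWeakly (fun n => ρ (φ n)) σ := by
  have hnorm : ∀ n, ‖(hρ n).memLp_two.toLp (ρ n)‖ ≤ 1 := fun n => by
    have h1 : ‖(hρ n).memLp_two.toLp (ρ n)‖ ^ 2 ≤ 1 := by
      rw [← real_inner_self_eq_norm_sq, L2.inner_def, ← hm n]
      refine integral_mono_ae (L2.integrable_inner _ _) (hρ n).integrable ?_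
      filter_upwards [(hρ n).memLp_two.coeFn_toLp] with x hx
      rw [hx, real_inner_self_eq_norm_sq, Real.norm_of_nonneg ((hρ n).mem_Icc x).1]
      nlinarith [((hρ n).mem_Icc x).1, ((hρ n).mem_Icc x).2]
    exact (sq_le_one_iff₀ (norm_nonneg _)).1 h1
  have : Fact ((2 : ℝ≥0∞) ≠ ⊤) := ⟨by simp⟩
  obtain ⟨φ, hφ, G, hG⟩ := exists_subseq_inner_tendsto _ hnorm
  have hlim : TendstoWeakly (fun n => ρ (φ n)) G := fun g hg => by
    have h := hG (hg.toLp g)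
    simp only [L2.inner_def] at h
    have h1 : ∫ x, inner ℝ ((G : 𝔼 → ℝ) x) ((hg.toLp g : 𝔼 → ℝ) x) = ∫ x, G x * g x := by
      refine integral_congr_ae ?_
      filter_upwards [hg.coeFn_toLp] with x hx
      rw [hx]
      simp [mul_comm]
    have h2 : ∀ n, ∫ x, inner ℝ (((hρ (φ n)).memLp_two.toLp (ρ (φ n)) : 𝔼 → ℝ) x)
        ((hg.toLp g : 𝔼 → ℝ) x) = ∫ x, ρ (φ n) x * g x := fun n => by
      refine integral_congr_ae ?_
      filter_upwards [hg.coeFn_toLp, (hρ (φ n)).memLp_two.coeFn_toLp] with x hx hx'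
      rw [hx, hx']
      simp [mul_comm]
    rw [h1] at h
    simpa only [h2] using h
  have hGint : ∀ s : Set 𝔼, MeasurableSet s → volume s < ⊤ → IntegrableOn (G : 𝔼 → ℝ) s :=
    fun s _ hs => integrableOn_Lp_of_measure_ne_top G (by norm_num) hs.ne
  have hG0 : 0 ≤ᵐ[volume] (G : 𝔼 → ℝ) :=
    ae_nonneg_of_forall_setIntegral_nonneg_of_sigmaFinite hGint fun s hs hs' =>
      ge_of_tendsto' (hlim.setIntegral hs hs') fun n =>
        integral_nonneg fun x => ((hρ (φ n)).mem_Icc x).1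
  have hG1 : 0 ≤ᵐ[volume] fun x => 1 - (G : 𝔼 → ℝ) x := by
    have hone : ∀ s : Set 𝔼, volume s < ⊤ → IntegrableOn (fun _ : 𝔼 => (1 : ℝ)) s :=
      fun s hs => integrableOn_const hs.ne
    refine ae_nonneg_of_forall_setIntegral_nonneg_of_sigmaFinite
      (fun s hs hs' => (hone s hs').sub (hGint s hs hs')) fun s hs hs' => ?_
    rw [integral_sub (hone s hs') (hGint s hs hs'), sub_nonneg]
    refine le_of_tendsto' (hlim.setIntegral hs hs') fun n => ?_
    exact integral_mono ((hρ (φ n)).isWeight.integrableOn hs') (hone s hs')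
      fun x => ((hρ (φ n)).mem_Icc x).2
  have hGm : Measurable (G : 𝔼 → ℝ) := (Lp.stronglyMeasurable G).measurable
  -- The L² limit lies in [0,1] almost everywhere only; truncation makes this hold everywhere.
  let σ : 𝔼 → ℝ := fun x => max 0 (min 1 (G x))
  have hσ : IsWeight σ := ⟨by fun_prop, fun x => ⟨le_max_left _ _,
    max_le zero_le_one (min_le_left _ _)⟩⟩
  have hae : σ =ᵐ[volume] G := by
    filter_upwards [hG0, hG1] with x h0 h1
    have h0' : 0 ≤ (G : 𝔼 → ℝ) x := h0
    have h1' : (G : 𝔼 → ℝ) x ≤ 1 := by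
      have : (0 : ℝ) ≤ 1 - (G : 𝔼 → ℝ) x := h1
      linarith
    simp [σ, h0', h1']
  have hlimσ : TendstoWeakly (fun n => ρ (φ n)) σ := fun g hg => by
    have h : ∫ x, σ x * g x = ∫ x, (G : 𝔼 → ℝ) x * g x :=
      integral_congr_ae (hae.mono fun x hx => by simp only [hx])
    rw [h]
    exact hlim g hg
  refine ⟨φ, hφ, σ, hσ, ?_, hlimσ⟩
  refine (aecover_closedBall (x := (0 : 𝔼)) (tendsto_natCast_atTop_atTop
    (R := ℝ))).integrable_of_integral_bounded_of_nonneg_ae 1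
    (fun R => hσ.integrableOn measure_closedBall_lt_top)
    (ae_of_all _ fun x => (hσ.mem_Icc x).1) (Eventually.of_forall fun R => ?_)
  refine le_of_tendsto' (hlimσ.setIntegral measurableSet_closedBall measure_closedBall_lt_top)
    fun n => ?_
  rw [← hm (φ n)]
  exact setIntegral_le_integral (hρ (φ n)).integrable
    (ae_of_all _ fun x => ((hρ (φ n)).mem_Icc x).1)

/-! ### Positive families of weak limits -/

/-- Positive definiteness is an open condition on the matrix, by compactness of the unit sphere;
homogeneity then covers all c ≠ 0. -/
theorem eventually_posDef_of_tendsto {ι : Type*} [Fintype ι] {M : ℕ → ι → ι → ℝ}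
    {M' : ι → ι → ℝ} (hM : ∀ a b, Tendsto (fun n => M n a b) atTop (𝓝 (M' a b)))
    (hpos : ∀ c : ι → ℝ, c ≠ 0 → 0 < ∑ a, ∑ b, c a * c b * M' a b) :
    ∀ᶠ n in atTop, ∀ c : ι → ℝ, c ≠ 0 → 0 < ∑ a, ∑ b, c a * c b * M n a b := by
  have hM' : Tendsto M atTop (𝓝 M') :=
    tendsto_pi_nhds.2 fun a => tendsto_pi_nhds.2 fun b => hM a b
  have hq : Continuous fun p : (ι → ι → ℝ) × (ι → ℝ) => ∑ a, ∑ b, p.2 a * p.2 b * p.1 a b := by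
    fun_prop
  have hev : ∀ᶠ A in 𝓝 M', ∀ c ∈ Metric.sphere (0 : ι → ℝ) 1,
      0 < ∑ a, ∑ b, c a * c b * A a b := by
    refine (isCompact_sphere (0 : ι → ℝ) 1).eventually_forall_of_forall_eventually fun c hc => ?_
    have hc0 : c ≠ 0 := fun h => by simp [h] at hc
    exact (hq.tendsto (M', c)).eventually_const_lt (hpos c hc0)
  filter_upwards [hM'.eventually hev] with n hn c hc
  have hnc : 0 < ‖c‖ := norm_pos_iff.2 hc
  have h := hn (‖c‖⁻¹ • c) (by simp [norm_smul, hnc.ne'])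
  have h2 : ∑ a, ∑ b, (‖c‖⁻¹ • c) a * (‖c‖⁻¹ • c) b * M n a b =
      ‖c‖⁻¹ ^ 2 * ∑ a, ∑ b, c a * c b * M n a b := by
    simp only [Finset.mul_sum, Pi.smul_apply, smul_eq_mul]
    exact Finset.sum_congr rfl fun a _ => Finset.sum_congr rfl fun b _ => by ring
  rw [h2] at h
  exact pos_of_mul_pos_right h (by positivity)

theorem memLp_lagrangian (t : ℝ) {u v : 𝔼 → ℝ} (hu : u ∈ testSpace N) (hv : v ∈ testSpace N) :
    MemLp (lagrangian t u v) 2 volume :=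
  (continuous_lagrangian t hu hv).memLp_of_hasCompactSupport
    (hasCompactSupport_lagrangian t v hu)

theorem lagrangian_comp_add (t : ℝ) {u v : 𝔼 → ℝ} (hu : u ∈ testSpace N) (hv : v ∈ testSpace N)
    (b x : 𝔼) :
    lagrangian t (fun y => u ((1 : ℝ) • y + b)) (fun y => v ((1 : ℝ) • y + b)) x =
      lagrangian t u v (x + b) := by
  simp only [lagrangian]
  rw [gradient_comp_smul_add (differentiable_of_mem_testSpace hu),
    gradient_comp_smul_add (differentiable_of_mem_testSpace hv)]
  simp

/-- Families that are positive for weak limits of translates along mutually diverging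
translations combine to a family that is positive along the sequence. -/
theorem eventually_hasPositiveFamily_of_profiles {ρ : ℕ → 𝔼 → ℝ} (hρ : ∀ n, IsWeight (ρ n))
    {j : ℕ} {y : Fin j → ℕ → 𝔼} {σ : Fin j → 𝔼 → ℝ} (hσ : ∀ i, IsWeight (σ i))
    (hy : ∀ i l, i ≠ l → Tendsto (fun n => ‖y i n - y l n‖) atTop atTop)
    (hlim : ∀ i, TendstoWeakly (fun n x => ρ n (x + y i n)) (σ i)) {t : ℝ} {d : Fin j → ℕ}
    (hd : ∀ i, HasPositiveFamily (σ i) t (d i)) :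
    ∀ᶠ n in atTop, HasPositiveFamily (ρ n) t (∑ i, d i) := by
  choose f hf hpos using hd
  let F : ℕ → (Σ i, Fin (d i)) → 𝔼 → ℝ := fun n p x => f p.1 p.2 ((1 : ℝ) • x + -(y p.1 n))
  have hF : ∀ n p, F n p ∈ testSpace N := fun n p =>
    comp_smul_add_mem_testSpace (hf p.1 p.2) one_pos _
  -- The limit Gram matrix is block diagonal: a diagonal block converges by weak convergence of the
  -- translates, and the entries off the blocks are eventually zero since the supports separate.
  let M' : (Σ i, Fin (d i)) → (Σ i, Fin (d i)) → ℝ := fun p q =>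
    if h : q.1 = p.1 then energyForm (σ p.1) t (f p.1 p.2) (f p.1 (h ▸ q.2)) else 0
  have hM : ∀ p q, Tendsto (fun n => energyForm (ρ n) t (F n p) (F n q)) atTop
      (𝓝 (M' p q)) := by
    rintro ⟨i, a⟩ ⟨l, b⟩
    by_cases h : l = i
    · subst h
      have h1 := hlim l _ (memLp_lagrangian t (hf l a) (hf l b))
      have h2 : ∀ n, energyForm (ρ n) t (F n ⟨l, a⟩) (F n ⟨l, b⟩) =
          ∫ x, ρ n (x + y l n) * lagrangian t (f l a) (f l b) x := fun n => by
        rw [energyForm, ← integral_add_right_eq_self _ (y l n)]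
        refine integral_congr_ae (ae_of_all _ fun x => ?_)
        simp only [F]
        rw [lagrangian_comp_add t (hf l a) (hf l b), add_neg_cancel_right]
      simp only [h2]
      simpa [M', energyForm] using h1
    · have hM0 : M' ⟨i, a⟩ ⟨l, b⟩ = 0 := by simp [M', h]
      rw [hM0]
      obtain ⟨r, hr⟩ := (hf i a).2.isCompact.isBounded.subset_closedBall 0
      obtain ⟨r', hr'⟩ := (hf l b).2.isCompact.isBounded.subset_closedBall 0
      refine tendsto_const_nhds.congr' ?_
      filter_upwards [(hy i l (Ne.symm h)).eventually_gt_atTop (r + r')] with n hn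
      symm
      refine integral_eq_zero_of_ae (ae_of_all _ fun x => ?_)
      have hout : ∀ i a, x + -(y i n) ∉ tsupport (f i a) →
          F n ⟨i, a⟩ x = 0 ∧ gradient (F n ⟨i, a⟩) x = 0 := fun i a hx => by
        constructor
        · simpa [F] using image_eq_zero_of_notMem_tsupport hx
        · simp only [F]
          rw [gradient_comp_smul_add (differentiable_of_mem_testSpace (hf i a)), one_smul,
            one_smul, gradient_eq_zero_of_notMem_tsupport hx]
      by_cases h1 : x + -(y i n) ∈ tsupport (f i a)
      · by_cases h2 : x + -(y l n) ∈ tsupport (f l b)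
        · have h3 := mem_closedBall_zero_iff.1 (hr h1)
          have h4 := mem_closedBall_zero_iff.1 (hr' h2)
          have h5 : y i n - y l n = (x + -(y l n)) - (x + -(y i n)) := by abel
          have h6 := norm_sub_le (x + -(y l n)) (x + -(y i n))
          rw [← h5] at h6
          linarith
        · simp [lagrangian, hout l b h2]
      · simp [lagrangian, hout i a h1]
  have hM'pos : ∀ c : (Σ i, Fin (d i)) → ℝ, c ≠ 0 → 0 < ∑ p, ∑ q, c p * c q * M' p q := by
    intro c hc
    have h1 : ∑ p, ∑ q, c p * c q * M' p q = ∑ i, energyForm (σ i) t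
        (∑ a, c ⟨i, a⟩ • f i a) (∑ a, c ⟨i, a⟩ • f i a) := by
      rw [Fintype.sum_sigma]
      refine Finset.sum_congr rfl fun i _ => ?_
      rw [(hσ i).energyForm_sum t _ _ (hf i)]
      refine Finset.sum_congr rfl fun a _ => ?_
      rw [Fintype.sum_sigma, Finset.sum_eq_single i]
      · simp [M']
      · intro l _ hl
        simp [M', hl]
      · simp
    rw [h1]
    have hnonneg : ∀ i, 0 ≤ energyForm (σ i) t
        (∑ a, c ⟨i, a⟩ • f i a) (∑ a, c ⟨i, a⟩ • f i a) := fun i => by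
      by_cases h0 : (fun a => c ⟨i, a⟩) = 0
      · have : ∀ a, c ⟨i, a⟩ = 0 := fun a => congrFun h0 a
        simp only [this, zero_smul, Finset.sum_const_zero]
        -- The zero function is written as an empty combination, which shows that the form vanishes
        -- there.
        have h00 := (hσ i).energyForm_sum_left (∅ : Finset ℕ) t (fun _ => 0)
          (f := fun _ => 0) (fun _ _ => (testSpace N).zero_mem) (testSpace N).zero_mem
        simp only [Finset.sum_empty] at h00
        exact h00.ge
      · exact (hpos i _ h0).le
    obtain ⟨⟨i, a⟩, hia⟩ := Function.ne_iff.1 hc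
    refine Finset.sum_pos' (fun i _ => hnonneg i) ⟨i, Finset.mem_univ _, hpos i _ fun h0 => ?_⟩
    exact hia (congrFun h0 a)
  filter_upwards [eventually_posDef_of_tendsto hM hM'pos] with n hn
  refine HasPositiveFamily.of_fintype (ι := Σ i, Fin (d i)) (by simp) (hF n) fun c hc => ?_
  rw [(hρ n).energyForm_sum t c c (hF n)]
  exact hn c hc

end WeakCompactness

/-! ### Small eigenvalues from mass that is spread out. -/

section Vanishing

open Filter Topology

variable {N : ℕ}

local notation "𝔼" => EuclideanSpace ℝ (Fin N)

theorem exists_cutoff (N : ℕ) : ∃ χ : EuclideanSpace ℝ (Fin N) → ℝ, χ ∈ testSpace N ∧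
    (∀ x, ‖x‖ ≤ 1 → χ x = 1) ∧ (tsupport χ ⊆ Metric.closedBall 0 2) ∧
    ∃ C : ℝ, 0 < C ∧ ∀ x, ‖gradient χ x‖ ≤ C := by
  let b : ContDiffBump (0 : EuclideanSpace ℝ (Fin N)) := ⟨1, 2, one_pos, one_lt_two⟩
  have hb : (b : EuclideanSpace ℝ (Fin N) → ℝ) ∈ testSpace N :=
    ⟨b.contDiff, b.hasCompactSupport⟩
  have hg : HasCompactSupport (gradient (b : EuclideanSpace ℝ (Fin N) → ℝ)) :=
    HasCompactSupport.intro b.hasCompactSupport fun x hx =>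
      gradient_eq_zero_of_notMem_tsupport hx
  obtain ⟨C, hC⟩ := hg.exists_bound_of_continuous (continuous_gradient hb)
  refine ⟨b, hb, fun x hx => b.one_of_mem_closedBall (by simpa using hx), ?_, max C 1,
    by positivity, fun x => (hC x).trans (le_max_left _ _)⟩
  rw [b.tsupport_eq]

/-- Separated groups of balls, each of them of mass at least `η`, produce test functions with
small Rayleigh quotients. -/
theorem exists_const_hasPositiveFamily_of_groups (N : ℕ) : ∃ C : ℝ, 0 < C ∧
    ∀ {ρ : EuclideanSpace ℝ (Fin N) → ℝ}, IsDensity ρ → ∀ {ι : Type} (Z : Finset ι)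
      (p : ι → EuclideanSpace ℝ (Fin N)) {k : ℕ} (c : ι → Fin (k + 1)) {r η t : ℝ}, 0 < r →
      (∀ z ∈ Z, ∀ z' ∈ Z, z ≠ z' → 4 * r < ‖p z - p z'‖) →
      (∀ g, η ≤ ∑ z ∈ Z with c z = g, ∫ x in Metric.closedBall (p z) r, ρ x) →
      0 < t → C ^ 2 * (∫ x, ρ x) < t * η * r ^ 2 → HasPositiveFamily ρ t (k + 1) := by
  classical
  obtain ⟨χ, hχ, hχ1, hχs, C, hC, hgrad⟩ := exists_cutoff N
  refine ⟨C, hC, fun {ρ} hρ {ι} Z p {k} c {r η t} hr hsep hη ht hlt => ?_⟩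
  have hri : 0 < r⁻¹ := inv_pos.2 hr
  let u : ι → EuclideanSpace ℝ (Fin N) → ℝ := fun z x => χ (r⁻¹ • x + -(r⁻¹ • p z))
  have hu : ∀ z, u z ∈ testSpace N := fun z => comp_smul_add_mem_testSpace hχ hri _
  have harg : ∀ z x, ‖r⁻¹ • x + -(r⁻¹ • p z)‖ = r⁻¹ * ‖x - p z‖ := fun z x => by
    rw [← sub_eq_add_neg, ← smul_sub, norm_smul, Real.norm_of_nonneg hri.le]
  have hug : ∀ z x, gradient (u z) x = r⁻¹ • gradient χ (r⁻¹ • x + -(r⁻¹ • p z)) := fun z x =>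
    gradient_comp_smul_add (differentiable_of_mem_testSpace hχ) _ _ x
  have hu1 : ∀ z x, x ∈ Metric.closedBall (p z) r → u z x = 1 := fun z x hx => by
    refine hχ1 _ ?_
    rw [harg, inv_mul_le_one₀ hr]
    simpa [dist_eq_norm] using hx
  have hout : ∀ z x, 2 * r < ‖x - p z‖ → u z x = 0 ∧ gradient (u z) x = 0 := fun z x hx => by
    have : r⁻¹ • x + -(r⁻¹ • p z) ∉ tsupport χ := fun h => by
      have h2 := mem_closedBall_zero_iff.1 (hχs h)
      rw [harg, inv_mul_le_iff₀ hr] at h2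
      linarith
    refine ⟨image_eq_zero_of_notMem_tsupport (f := χ) this, ?_⟩
    rw [hug, gradient_eq_zero_of_notMem_tsupport this, smul_zero]
  have hfar : ∀ x, ∀ z ∈ Z, ‖x - p z‖ ≤ 2 * r → ∀ z' ∈ Z, z' ≠ z → 2 * r < ‖x - p z'‖ := by
    intro x z hz hx z' hz' hne
    have h1 := hsep z' hz' z hz hne
    have h2 : p z' - p z = (x - p z) - (x - p z') := by abel
    have h3 := norm_sub_le (x - p z) (x - p z')
    rw [← h2] at h3
    linarith
  refine ⟨fun g => ∑ z ∈ Z with c z = g, u z, fun g => Submodule.sum_mem _ fun z _ => hu z,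
    fun a ha => ?_⟩
  have hv : ∑ g, a g • ∑ z ∈ Z with c z = g, u z = ∑ z ∈ Z, a (c z) • u z := by
    rw [← Finset.sum_fiberwise Z c]
    refine Finset.sum_congr rfl fun g _ => ?_
    rw [Finset.smul_sum]
    exact Finset.sum_congr rfl fun z hz => by rw [(Finset.mem_filter.1 hz).2]
  have hvt : ∑ z ∈ Z, a (c z) • u z ∈ testSpace N :=
    sum_smul_mem_testSpace Z (fun z => a (c z)) fun z _ => hu z
  rw [hv, hρ.isWeight.energyForm_self _ hvt]
  set v := ∑ z ∈ Z, a (c z) • u z with hvdef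
  -- With A the largest |a g|, disjointness of the supports gives |∇v| ≤ AC/r everywhere, while the
  -- group g₀ alone gives ∫ρv² ≥ A²η.
  obtain ⟨g₀, -, hg₀⟩ := Finset.exists_max_image Finset.univ (fun g => |a g|)
    Finset.univ_nonempty
  have hA : 0 < a g₀ ^ 2 := by
    obtain ⟨g, hg⟩ := Function.ne_iff.1 ha
    have := (abs_pos.2 hg).trans_le (hg₀ g (Finset.mem_univ _))
    rw [← sq_abs]
    positivity
  have hgradv : ∀ x, ‖gradient v x‖ ^ 2 ≤ a g₀ ^ 2 * (r⁻¹ * C) ^ 2 := fun x => by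
    rw [hvdef, gradient_sum_smul Z _ fun z _ => hu z, ← sq_abs (a g₀), ← mul_pow]
    refine pow_le_pow_left₀ (norm_nonneg _) ?_ 2
    by_cases hx : ∃ z ∈ Z, ‖x - p z‖ ≤ 2 * r
    · obtain ⟨z, hz, hxz⟩ := hx
      rw [Finset.sum_eq_single_of_mem z hz fun z' hz' hne => by
        rw [(hout z' x (hfar x z hz hxz z' hz' hne)).2, smul_zero], hug, norm_smul, norm_smul,
        Real.norm_eq_abs, Real.norm_of_nonneg hri.le]
      exact mul_le_mul (hg₀ _ (Finset.mem_univ _))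
        (mul_le_mul_of_nonneg_left (hgrad _) hri.le) (by positivity) (abs_nonneg _)
    · push Not at hx
      rw [Finset.sum_eq_zero fun z hz => by rw [(hout z x (hx z hz)).2, smul_zero], norm_zero]
      positivity
  have hsqv : ∀ x, a g₀ ^ 2 * ∑ z ∈ Z with c z = g₀,
      (Metric.closedBall (p z) r).indicator (fun _ => (1 : ℝ)) x ≤ v x ^ 2 := fun x => by
    by_cases hx : ∃ z ∈ Z, c z = g₀ ∧ x ∈ Metric.closedBall (p z) r
    · obtain ⟨z, hz, hcz, hxz⟩ := hx
      have hxz2 : ‖x - p z‖ ≤ 2 * r := by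
        have : ‖x - p z‖ ≤ r := by simpa [dist_eq_norm] using hxz
        linarith
      have hvx : v x = a g₀ := by
        rw [hvdef, Finset.sum_apply, Finset.sum_eq_single_of_mem z hz fun z' hz' hne => by
          rw [Pi.smul_apply, (hout z' x (hfar x z hz hxz2 z' hz' hne)).1, smul_zero],
          Pi.smul_apply, hu1 z x hxz, hcz, smul_eq_mul, mul_one]
      rw [hvx, Finset.sum_eq_single_of_mem z (Finset.mem_filter.2 ⟨hz, hcz⟩)]
      · simp [hxz]
      · intro z' hz' hne
        refine Set.indicator_of_notMem (fun hx' => ?_) _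
        have h1 := hfar x z hz hxz2 z' (Finset.mem_filter.1 hz').1 hne
        have : ‖x - p z'‖ ≤ r := by simpa [dist_eq_norm] using hx'
        linarith
    · push Not at hx
      rw [Finset.sum_eq_zero fun z hz => Set.indicator_of_notMem
        (hx z (Finset.mem_filter.1 hz).1 (Finset.mem_filter.1 hz).2) _, mul_zero]
      positivity
  have hmul : ∀ z, (fun x => ρ x * (Metric.closedBall (p z) r).indicator (fun _ => (1 : ℝ)) x) =
      (Metric.closedBall (p z) r).indicator ρ := fun z => by
    ext x
    by_cases hx : x ∈ Metric.closedBall (p z) r <;> simp [hx]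
  have hlow : a g₀ ^ 2 * η ≤ ∫ x, ρ x * v x ^ 2 := by
    calc a g₀ ^ 2 * η ≤ a g₀ ^ 2 * ∑ z ∈ Z with c z = g₀,
          ∫ x in Metric.closedBall (p z) r, ρ x :=
          mul_le_mul_of_nonneg_left (hη g₀) hA.le
      _ = ∫ x, a g₀ ^ 2 * ∑ z ∈ Z with c z = g₀, (Metric.closedBall (p z) r).indicator ρ x := by
          rw [integral_const_mul, integral_finsetSum _ fun z _ =>
            hρ.integrable.indicator measurableSet_closedBall]
          congr 1
          exact Finset.sum_congr rfl fun z _ => (integral_indicator measurableSet_closedBall).symm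
      _ ≤ _ := by
          refine integral_mono ((integrable_finsetSum _ fun z _ =>
            hρ.integrable.indicator measurableSet_closedBall).const_mul _)
            (hρ.isWeight.integrable_sq hvt) fun x => ?_
          have h1 := mul_le_mul_of_nonneg_left (hsqv x) (hρ.mem_Icc x).1
          refine le_trans (le_of_eq ?_) h1
          simp only [← hmul, ← Finset.mul_sum]
          ring
  have hup : ∫ x, ρ x * ‖gradient v x‖ ^ 2 ≤ a g₀ ^ 2 * (r⁻¹ * C) ^ 2 * ∫ x, ρ x := by
    rw [← integral_const_mul]
    refine integral_mono (hρ.isWeight.integrable_gradient_sq hvt)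
      (hρ.integrable.const_mul _) fun x => ?_
    have h1 := mul_le_mul_of_nonneg_left (hgradv x) (hρ.mem_Icc x).1
    calc _ ≤ _ := h1
      _ = _ := by ring
  have hfin : (r⁻¹ * C) ^ 2 * ∫ x, ρ x < t * η := by
    rw [mul_pow, inv_pow, mul_assoc, inv_mul_lt_iff₀ (by positivity)]
    linarith
  have h1 := mul_lt_mul_of_pos_left hfin hA
  have h2 := mul_le_mul_of_nonneg_left hlow ht.le
  linarith

theorem exists_subset_le_sum_le {ι : Type*} (s : Finset ι) {a : ι → ℝ} {δ : ℝ} (hδ : 0 < δ)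
    (ha : ∀ z ∈ s, a z ≤ δ) (hs : δ ≤ ∑ z ∈ s, a z) :
    ∃ T ⊆ s, δ ≤ ∑ z ∈ T, a z ∧ ∑ z ∈ T, a z ≤ 2 * δ := by
  classical
  induction s using Finset.induction_on with
  | empty => simp at hs; linarith
  | insert x s hx ih =>
    by_cases h : δ ≤ ∑ z ∈ s, a z
    · obtain ⟨T, hT, h1⟩ := ih (fun z hz => ha z (Finset.mem_insert_of_mem hz)) h
      exact ⟨T, hT.trans (Finset.subset_insert _ _), h1⟩
    · refine ⟨insert x s, subset_rfl, hs, ?_⟩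
      rw [Finset.sum_insert hx]
      have := ha x (Finset.mem_insert_self _ _)
      linarith

/-- Groups are peeled off greedily. As no weight exceeds δ, each peeled group can be kept below 2δ,
and the rest still suffices for the remaining groups. -/
theorem exists_groups {ι : Type*} [DecidableEq ι] {a : ι → ℝ} (ha0 : ∀ z, 0 ≤ a z) {δ : ℝ}
    (hδ : 0 < δ) (k : ℕ) (s : Finset ι) (ha : ∀ z ∈ s, a z ≤ δ)
    (hs : 2 * (k + 1) * δ ≤ ∑ z ∈ s, a z) :
    ∃ c : ι → Fin (k + 1), ∀ g, δ ≤ ∑ z ∈ s with c z = g, a z := by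
  induction k generalizing s with
  | zero =>
    refine ⟨fun _ => 0, fun g => ?_⟩
    rw [Finset.filter_true_of_mem fun _ _ => (Fin.fin_one_eq_zero g).symm]
    norm_num at hs
    linarith
  | succ k ih =>
    push_cast at hs
    have hk : (0 : ℝ) ≤ k := k.cast_nonneg
    obtain ⟨T, hT, h1, h2⟩ := exists_subset_le_sum_le s hδ ha (by nlinarith)
    have h3 := Finset.sum_sdiff hT (f := a)
    obtain ⟨c, hc⟩ := ih (s \ T) (fun z hz => ha z (Finset.sdiff_subset hz)) (by nlinarith)
    refine ⟨fun z => if z ∈ T then Fin.last _ else (c z).castSucc, fun g => ?_⟩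
    refine Fin.lastCases ?_ (fun g => ?_) g
    · refine h1.trans (Finset.sum_le_sum_of_subset_of_nonneg (fun z hz => ?_) fun z _ _ => ha0 z)
      simp [hz, hT hz]
    · refine (hc g).trans
        (Finset.sum_le_sum_of_subset_of_nonneg (fun z hz => ?_) fun z _ _ => ha0 z)
      simp only [Finset.mem_filter, Finset.mem_sdiff] at hz ⊢
      simp [hz]

/-! ### Lattice coverings -/

/-- The point `ℓ z` of the lattice `ℓ ℤ^N`. -/
noncomputable def latticePoint (ℓ : ℝ) (z : Fin N → ℤ) : 𝔼 := WithLp.toLp 2 fun i => ℓ * z i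

theorem abs_coord_le_norm (x : 𝔼) (i : Fin N) : |x i| ≤ ‖x‖ := by
  simpa using PiLp.norm_apply_le x i

theorem norm_sub_latticePoint_floor_le {ℓ : ℝ} (hℓ : 0 < ℓ) (x : 𝔼) :
    ‖x - latticePoint ℓ fun i => ⌊x i / ℓ⌋‖ ≤ N * ℓ := by
  rw [EuclideanSpace.norm_eq]
  refine Real.sqrt_le_iff.2 ⟨by positivity, ?_⟩
  have h : ∀ i, ‖(x - latticePoint ℓ fun i => ⌊x i / ℓ⌋) i‖ ^ 2 ≤ ℓ ^ 2 := fun i => by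
    have h1 : (x - latticePoint ℓ fun i => ⌊x i / ℓ⌋) i = ℓ * Int.fract (x i / ℓ) := by
      rw [Int.fract, mul_sub, mul_div_cancel₀ _ hℓ.ne']
      simp [latticePoint]
    rw [h1, Real.norm_of_nonneg (mul_nonneg hℓ.le (Int.fract_nonneg _))]
    refine pow_le_pow_left₀ (mul_nonneg hℓ.le (Int.fract_nonneg _)) ?_ 2
    exact mul_le_of_le_one_right hℓ.le (Int.fract_lt_one _).le
  refine (Finset.sum_le_sum fun i _ => h i).trans ?_
  rw [Finset.sum_const, Finset.card_univ, Fintype.card_fin, nsmul_eq_mul, mul_pow]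
  refine mul_le_mul_of_nonneg_right ?_ (sq_nonneg _)
  have : N ≤ N ^ 2 := Nat.le_self_pow (by norm_num) N
  exact_mod_cast this

theorem le_norm_latticePoint_sub {ℓ : ℝ} (hℓ : 0 < ℓ) {m : ℕ} {z z' : Fin N → ℤ} (hne : z ≠ z')
    (h : ∀ i, (z i : ZMod m) = z' i) :
    m * ℓ ≤ ‖(latticePoint ℓ z : 𝔼) - latticePoint ℓ z'‖ := by
  obtain ⟨i, hi⟩ := Function.ne_iff.1 hne
  refine le_trans ?_ (abs_coord_le_norm _ i)
  have h1 : ((latticePoint ℓ z : 𝔼) - latticePoint ℓ z') i = ℓ * ((z i - z' i : ℤ) : ℝ) := by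
    simp [latticePoint, mul_sub]
  have h2 : (m : ℤ) ≤ |z i - z' i| := by
    have h3 : (m : ℤ) ∣ z i - z' i := (ZMod.intCast_eq_intCast_iff_dvd_sub _ _ _).1 (h i).symm
    exact Int.le_of_dvd (abs_pos.2 (sub_ne_zero.2 hi)) ((dvd_abs _ _).2 h3)
  rw [h1, abs_mul, abs_of_pos hℓ, mul_comm]
  refine mul_le_mul_of_nonneg_left ?_ hℓ.le
  exact_mod_cast h2

theorem tendsto_setIntegral_closedBall {f : 𝔼 → ℝ} (hf : Integrable f) :
    Tendsto (fun R : ℝ => ∫ x in Metric.closedBall 0 R, f x) atTop (𝓝 (∫ x, f x)) :=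
  (aecover_closedBall tendsto_id).integral_tendsto_of_countably_generated hf

/-- A density with a part of mass `η` that vanishes locally has many small eigenvalues. -/
theorem exists_hasPositiveFamily_of_vanishing (hN : 1 ≤ N) (k : ℕ) {η t : ℝ} (hη : 0 < η)
    (ht : 0 < t) : ∃ R δ : ℝ, 0 < R ∧ 0 < δ ∧ ∀ ρ : 𝔼 → ℝ, IsDensity ρ → ∫ x, ρ x = 1 →
      ∀ U : Set 𝔼, MeasurableSet U → η ≤ ∫ x in U, ρ x →
        (∀ y, ∫ x in Metric.closedBall y R ∩ U, ρ x ≤ δ) → HasPositiveFamily ρ t (k + 1) := by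
  classical
  obtain ⟨C, hC, hgroups⟩ := exists_const_hasPositiveFamily_of_groups N
  have hN' : (0 : ℝ) < N := by exact_mod_cast hN
  -- Balls of radius r = Nℓ about the points of ℓℤ^N cover the space. Two points in the same class
  -- modulo 5N are at distance at least 5r, more than the 4r needed for disjoint cutoffs. Some class
  -- carries a fraction 1/P of the mass, and δ is chosen so that this class splits into k+1 groups.
  have : NeZero (5 * N) := ⟨by omega⟩
  set P : ℕ := Fintype.card (Fin N → ZMod (5 * N)) with hP
  have hP0 : (0 : ℝ) < P := by exact_mod_cast Fintype.card_pos
  set δ : ℝ := η / 2 / P / (2 * (k + 1)) with hδdef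
  have hδ : 0 < δ := by positivity
  obtain ⟨ℓ, hℓ, hCℓ⟩ : ∃ ℓ : ℝ, 0 < ℓ ∧ C ^ 2 < t * δ * (N * ℓ) ^ 2 := by
    have hlim : Tendsto (fun ℓ : ℝ => t * δ * (N * ℓ) ^ 2) atTop atTop := by
      refine Tendsto.const_mul_atTop (by positivity) ?_
      exact (tendsto_pow_atTop two_ne_zero).comp (tendsto_id.const_mul_atTop hN')
    obtain ⟨ℓ, h1, h2⟩ := ((eventually_gt_atTop 0).and (hlim.eventually_gt_atTop (C ^ 2))).exists
    exact ⟨ℓ, h1, h2⟩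
  refine ⟨N * ℓ, δ, by positivity, hδ, fun ρ hρ hm U hU hηU hloc => ?_⟩
  set r : ℝ := N * ℓ
  have hr : 0 < r := by positivity
  have hρ0 : ∀ x, 0 ≤ ρ x := fun x => (hρ.mem_Icc x).1
  -- Half of the mass is given up to work in a bounded region, met by finitely many lattice cells.
  obtain ⟨L, hL0, hL⟩ : ∃ L : ℝ, 0 ≤ L ∧
      η / 2 < ∫ x in Metric.closedBall 0 L, U.indicator ρ x := by
    have h := tendsto_setIntegral_closedBall (hρ.integrable.indicator hU)
    rw [integral_indicator hU] at h
    obtain ⟨L, h1, h2⟩ := ((eventually_ge_atTop 0).and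
      (h.eventually_const_lt (by linarith : η / 2 < _))).exists
    exact ⟨L, h1, h2⟩
  let s : Finset (Fin N → ℤ) := Fintype.piFinset fun _ => Finset.Icc (-(⌈L / ℓ⌉ + 1)) (⌈L / ℓ⌉ + 1)
  let a : (Fin N → ℤ) → ℝ := fun z => ∫ x in Metric.closedBall (latticePoint ℓ z) r ∩ U, ρ x
  have ha0 : ∀ z, 0 ≤ a z := fun z => integral_nonneg fun x => hρ0 x
  have hcover : η / 2 ≤ ∑ z ∈ s, a z := by
    have hmeas : ∀ z, MeasurableSet (Metric.closedBall (latticePoint ℓ z : 𝔼) r ∩ U) :=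
      fun z => measurableSet_closedBall.inter hU
    have h1 : ∑ z ∈ s, a z =
        ∫ x, ∑ z ∈ s, (Metric.closedBall (latticePoint ℓ z) r ∩ U).indicator ρ x := by
      rw [integral_finsetSum _ fun z _ => hρ.integrable.indicator (hmeas z)]
      exact Finset.sum_congr rfl fun z _ => (integral_indicator (hmeas z)).symm
    rw [h1]
    refine hL.le.trans ?_
    rw [← integral_indicator measurableSet_closedBall]
    refine integral_mono ((hρ.integrable.indicator hU).indicator measurableSet_closedBall)
      (integrable_finsetSum _ fun z _ => hρ.integrable.indicator (hmeas z)) fun x => ?_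
    have hnn : ∀ z ∈ s, 0 ≤ (Metric.closedBall (latticePoint ℓ z) r ∩ U).indicator ρ x :=
      fun z _ => Set.indicator_nonneg (fun x _ => hρ0 x) x
    by_cases hx : x ∈ Metric.closedBall (0 : 𝔼) L ∧ x ∈ U
    · have hzs : (fun i => ⌊x i / ℓ⌋) ∈ s := by
        refine Fintype.mem_piFinset.2 fun i => Finset.mem_Icc.2 ?_
        have h2 : |x i| ≤ L := (abs_coord_le_norm x i).trans (by simpa using hx.1)
        have h3 := abs_le.1 h2
        have h4 : x i / ℓ ≤ L / ℓ := div_le_div_of_nonneg_right h3.2 hℓ.le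
        have h5 : -(L / ℓ) ≤ x i / ℓ := by
          rw [← neg_div]
          exact div_le_div_of_nonneg_right h3.1 hℓ.le
        have h6 := Int.le_ceil (L / ℓ)
        constructor
        · rw [Int.le_floor]
          push_cast
          linarith
        · have : (⌊x i / ℓ⌋ : ℝ) ≤ ((⌈L / ℓ⌉ + 1 : ℤ) : ℝ) := by
            push_cast
            linarith [Int.floor_le (x i / ℓ)]
          exact_mod_cast this
      have hxB : x ∈ Metric.closedBall (latticePoint ℓ fun i => ⌊x i / ℓ⌋) r ∩ U := by
        refine ⟨?_, hx.2⟩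
        rw [Metric.mem_closedBall, dist_eq_norm]
        exact norm_sub_latticePoint_floor_le hℓ x
      refine le_trans ?_ (Finset.single_le_sum hnn hzs)
      simp [hx.1, hx.2, Set.indicator_of_mem hxB]
    · refine le_trans (le_of_eq ?_) (Finset.sum_nonneg hnn)
      by_cases h1 : x ∈ Metric.closedBall (0 : 𝔼) L
      · have h2 : x ∉ U := fun h2 => hx ⟨h1, h2⟩
        simp [h1, h2]
      · exact Set.indicator_of_notMem h1 _
  obtain ⟨κ, -, hκ⟩ := Finset.exists_le_sum_fiber_of_maps_to_of_nsmul_le_sum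
    (s := s) (t := Finset.univ) (f := fun z : Fin N → ℤ => fun i => (z i : ZMod (5 * N)))
    (w := a) (b := η / 2 / P) (fun _ _ => Finset.mem_univ _) Finset.univ_nonempty (by
      rw [Finset.card_univ, nsmul_eq_mul, ← hP, mul_div_cancel₀ _ hP0.ne']
      exact hcover)
  set Z := s.filter fun z : Fin N → ℤ => (fun i => (z i : ZMod (5 * N))) = κ
  obtain ⟨c, hc⟩ := exists_groups ha0 hδ k Z (fun z _ => hloc _) (by
    refine le_trans (le_of_eq ?_) hκ
    rw [hδdef]
    field_simp)
  refine hgroups hρ Z (latticePoint ℓ) c hr (fun z hz z' hz' hne => ?_) (fun g => ?_) ht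
    (by rw [hm, mul_one]; exact hCℓ)
  · have h1 := le_norm_latticePoint_sub (N := N) hℓ (m := 5 * N) hne fun i =>
      congrFun ((Finset.mem_filter.1 hz).2.trans (Finset.mem_filter.1 hz').2.symm) i
    refine lt_of_lt_of_le ?_ h1
    push_cast
    linarith
  · refine (hc g).trans (Finset.sum_le_sum fun z _ => ?_)
    exact setIntegral_mono_set hρ.integrable.integrableOn (ae_of_all _ fun x => hρ0 x)
      (Set.inter_subset_left.eventuallyLE)

/-- A cutoff equal to 1 on a large ball has a small Rayleigh quotient, because its gradient is of
order 1/r. -/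
theorem IsDensity.hasPositiveFamily_one {ρ : 𝔼 → ℝ} (hρ : IsDensity ρ) {t : ℝ} (ht : 0 < t) :
    HasPositiveFamily ρ t 1 := by
  obtain ⟨C, hC, hgroups⟩ := exists_const_hasPositiveFamily_of_groups N
  have hm := hρ.mass_pos
  have h1 := (tendsto_setIntegral_closedBall hρ.integrable).eventually_const_lt
    (half_lt_self hm)
  have h2 : Tendsto (fun r : ℝ => t * ((∫ x, ρ x) / 2) * r ^ 2) atTop atTop :=
    (tendsto_pow_atTop two_ne_zero).const_mul_atTop (by positivity)
  obtain ⟨r, hr, hr1, hr2⟩ := ((eventually_gt_atTop 0).and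
    (h1.and (h2.eventually_gt_atTop (C ^ 2 * ∫ x, ρ x)))).exists
  refine hgroups hρ (k := 0) ({()} : Finset Unit) (fun _ => 0) (fun _ => 0) hr ?_ ?_ ht hr2
  · intro z _ z' _ hne
    exact absurd (Subsingleton.elim z z') hne
  · intro g
    have : g = 0 := Fin.fin_one_eq_zero g
    simpa [this] using hr1.le

theorem IsDensity.densityEigenvalue_zero {ρ : 𝔼 → ℝ} (hρ : IsDensity ρ) :
    densityEigenvalue ρ 0 = 0 := by
  refine le_antisymm (densityEigenvalue_le_of_forall fun t ht => ?_) bot_le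
  exact densityEigenvalue_le_of_hasPositiveFamily hρ.isWeight
    (hρ.hasPositiveFamily_one (ENNReal.ofReal_pos.1 ht))

end Vanishing

/-! ### Extraction of profiles from a sequence of densities. -/

section Profiles

open Filter Topology

variable {N : ℕ}

local notation "𝔼" => EuclideanSpace ℝ (Fin N)

/-- Nontrivial weak limits of a subsequence of `ρ` seen from mutually diverging centers. -/
structure IsProfileFamily (ρ : ℕ → 𝔼 → ℝ) {j : ℕ} (φ : ℕ → ℕ) (y : Fin j → ℕ → 𝔼)
    (σ : Fin j → 𝔼 → ℝ) : Prop where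
  strictMono : StrictMono φ
  diverge : ∀ i l, i ≠ l → Tendsto (fun n => ‖y i n - y l n‖) atTop atTop
  isDensity : ∀ i, IsDensity (σ i)
  tendstoWeakly : ∀ i, TendstoWeakly (fun n x => ρ (φ n) (x + y i n)) (σ i)

theorem setIntegral_closedBall_add (f : 𝔼 → ℝ) (x : 𝔼) (R : ℝ) :
    ∫ z in Metric.closedBall 0 R, f (z + x) = ∫ z in Metric.closedBall x R, f z := by
  rw [← integral_indicator measurableSet_closedBall, ← integral_indicator measurableSet_closedBall,
    ← integral_add_right_eq_self ((Metric.closedBall x R).indicator f) x]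
  refine integral_congr_ae (ae_of_all _ fun z => ?_)
  simp [Set.indicator, dist_eq_norm]

/-- Mass that does not vanish away from the centers of a profile family yields a further
profile. -/
theorem IsProfileFamily.exists_succ {ρ : ℕ → 𝔼 → ℝ} (hρ : ∀ n, IsDensity (ρ n))
    (hm : ∀ n, ∫ x, ρ n x = 1) {j : ℕ} {φ : ℕ → ℕ} {y : Fin j → ℕ → 𝔼} {σ : Fin j → 𝔼 → ℝ}
    (h : IsProfileFamily ρ φ y σ) {R δ : ℝ} (hδ : 0 < δ)
    (hmass : ∀ m : ℕ, ∃ᶠ n in atTop, ∃ x, δ <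
      ∫ z in Metric.closedBall x R ∩ (⋃ i, Metric.closedBall (y i n) m)ᶜ, ρ (φ n) z) :
    ∃ (φ' : ℕ → ℕ) (y' : Fin (j + 1) → ℕ → 𝔼) (σ' : Fin (j + 1) → 𝔼 → ℝ),
      IsProfileFamily ρ φ' y' σ' := by
  obtain ⟨ψ, hψ, hx⟩ := extraction_forall_of_frequently hmass
  choose x hx using hx
  have hdens : ∀ m, IsDensity fun z => ρ (φ (ψ m)) (z + x m) := fun m => by
    simpa using (hρ (φ (ψ m))).comp_smul_add one_pos (x m)
  obtain ⟨θ, hθ, τ, hτw, hτi, hτ⟩ := exists_tendstoWeakly hdens fun m => by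
    rw [integral_add_right_eq_self]
    exact hm _
  -- A center closer than m − R to an old one would have its whole ball of radius R removed, leaving
  -- no mass.
  have hfar : ∀ (m : ℕ) i, (m : ℝ) - R ≤ ‖x m - y i (ψ m)‖ := fun m i => by
    by_contra! hlt
    have hempty : Metric.closedBall (x m) R ∩
        (⋃ i, Metric.closedBall (y i (ψ m)) m)ᶜ = ∅ := by
      rw [← Set.sdiff_eq, Set.sdiff_eq_empty]
      refine subset_trans (fun z hz => ?_) (Set.subset_iUnion _ i)
      have h1 := Metric.mem_closedBall.1 hz
      have h2 := dist_triangle z (x m) (y i (ψ m))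
      rw [dist_eq_norm (x m)] at h2
      exact Metric.mem_closedBall.2 (by linarith)
    have := hx m
    rw [hempty] at this
    simp at this
    linarith
  have hfar' : ∀ i, Tendsto (fun n => ‖x (θ n) - y i (ψ (θ n))‖) atTop atTop := fun i => by
    refine tendsto_atTop_mono (fun n => hfar (θ n) i) ?_
    exact tendsto_atTop_add_const_right _ _
      (tendsto_natCast_atTop_atTop.comp hθ.tendsto_atTop)
  have hτmass : 0 < ∫ z, τ z := by
    have h1 := hτ.setIntegral (s := Metric.closedBall 0 R) measurableSet_closedBall
      measure_closedBall_lt_top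
    have h2 : δ ≤ ∫ z in Metric.closedBall 0 R, τ z := by
      refine ge_of_tendsto' h1 fun n => ?_
      rw [setIntegral_closedBall_add]
      refine (hx (θ n)).le.trans ?_
      exact setIntegral_mono_set (hρ _).integrable.integrableOn
        (ae_of_all _ fun z => ((hρ _).mem_Icc z).1) (Set.inter_subset_left.eventuallyLE)
    have h3 : ∫ z in Metric.closedBall 0 R, τ z ≤ ∫ z, τ z :=
      setIntegral_le_integral hτi (ae_of_all _ fun z => (hτw.mem_Icc z).1)
    linarith
  refine ⟨fun n => φ (ψ (θ n)), Fin.cons (fun n => x (θ n)) fun i n => y i (ψ (θ n)),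
    Fin.cons τ σ, h.strictMono.comp (hψ.comp hθ), ?_, ?_, ?_⟩
  · intro i l
    refine Fin.cases ?_ (fun i => ?_) i <;> refine Fin.cases ?_ (fun l => ?_) l
    · exact fun h => absurd rfl h
    · intro _
      simpa using hfar' l
    · intro _
      simpa [norm_sub_rev] using hfar' i
    · intro hil
      have hil' : i ≠ l := fun h => hil (by rw [h])
      exact (h.diverge i l hil').comp (hψ.comp hθ).tendsto_atTop
  · intro i
    refine Fin.cases ?_ (fun i => ?_) i
    · exact ⟨hτw.measurable, hτw.mem_Icc, hτi, hτmass⟩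
    · exact h.isDensity i
  · intro i
    refine Fin.cases ?_ (fun i => ?_) i
    · exact hτ
    · exact (h.tendstoWeakly i).comp (hψ.comp hθ)

theorem IsProfileFamily.sum_le {ρ : ℕ → 𝔼 → ℝ} (hρ : ∀ n, IsDensity (ρ n)) {j : ℕ} {φ : ℕ → ℕ}
    {y : Fin j → ℕ → 𝔼} {σ : Fin j → 𝔼 → ℝ} (h : IsProfileFamily ρ φ y σ) {k : ℕ} {t : ℝ}
    (ht : ∀ᶠ n in atTop, ENNReal.ofReal t < densityEigenvalue (ρ n) k) {d : Fin j → ℕ}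
    (hd : ∀ i, HasPositiveFamily (σ i) t (d i)) : ∑ i, d i ≤ k := by
  by_contra! hlt
  have h1 := eventually_hasPositiveFamily_of_profiles (fun n => (hρ (φ n)).isWeight)
    (fun i => (h.isDensity i).isWeight) h.diverge h.tendstoWeakly hd
  obtain ⟨n, hn1, hn2⟩ := (h1.and (h.strictMono.tendsto_atTop.eventually ht)).exists
  exact absurd (densityEigenvalue_le_of_hasPositiveFamily (hρ (φ n)).isWeight
    (hn1.mono_index hlt)) (not_le.2 hn2)

theorem hasPositiveFamily_zero (ρ : 𝔼 → ℝ) (t : ℝ) : HasPositiveFamily ρ t 0 :=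
  ⟨fun _ => 0, fun _ => (testSpace N).zero_mem, fun _ hc => absurd (Subsingleton.elim _ _) hc⟩

/-- If mass were lost, a fixed amount of it would stay outside large balls about the centers. As no
further profile exists, this part vanishes locally and yields k+1 eigenvalues at most t. -/
theorem IsProfileFamily.one_le_sum_mass (hN : 1 ≤ N) {ρ : ℕ → 𝔼 → ℝ}
    (hρ : ∀ n, IsDensity (ρ n)) (hm : ∀ n, ∫ x, ρ n x = 1) {j : ℕ} {φ : ℕ → ℕ}
    {y : Fin j → ℕ → 𝔼} {σ : Fin j → 𝔼 → ℝ} (h : IsProfileFamily ρ φ y σ) {k : ℕ} {t : ℝ}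
    (ht0 : 0 < t) (ht : ∀ᶠ n in atTop, ENNReal.ofReal t < densityEigenvalue (ρ n) k)
    (hmax : ¬ ∃ (φ' : ℕ → ℕ) (y' : Fin (j + 1) → ℕ → 𝔼) (σ' : Fin (j + 1) → 𝔼 → ℝ),
      IsProfileFamily ρ φ' y' σ') : 1 ≤ ∑ i, ∫ x, σ i x := by
  by_contra! hlt
  set η : ℝ := (1 - ∑ i, ∫ x, σ i x) / 2 with hηdef
  have hη : 0 < η := by linarith
  obtain ⟨R, δ, hR, hδ, hvan⟩ := exists_hasPositiveFamily_of_vanishing hN k hη ht0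
  obtain ⟨m, hres⟩ : ∃ m : ℕ, ∀ᶠ n in atTop, ∀ x,
      ∫ z in Metric.closedBall x R ∩ (⋃ i, Metric.closedBall (y i n) m)ᶜ, ρ (φ n) z ≤ δ := by
    by_contra hno
    refine hmax (h.exists_succ hρ hm (R := R) hδ fun m hev => hno ⟨m, ?_⟩)
    filter_upwards [hev] with n hn x
    exact not_lt.1 fun hx => hn ⟨x, hx⟩
  have hballs : ∀ᶠ n in atTop,
      ∑ i, ∫ z in Metric.closedBall (y i n) m, ρ (φ n) z < 1 - η := by
    have h1 := tendsto_finsetSum Finset.univ fun i _ => (h.tendstoWeakly i).setIntegral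
      (s := Metric.closedBall 0 (m : ℝ)) measurableSet_closedBall measure_closedBall_lt_top
    simp only [setIntegral_closedBall_add] at h1
    refine h1.eventually_lt_const ?_
    have h2 : ∑ i, ∫ x in Metric.closedBall 0 (m : ℝ), σ i x ≤ ∑ i, ∫ x, σ i x :=
      Finset.sum_le_sum fun i _ => setIntegral_le_integral (h.isDensity i).integrable
        (ae_of_all _ fun z => ((h.isDensity i).mem_Icc z).1)
    linarith
  obtain ⟨n, hn1, hn2, hn3⟩ :=
    (hres.and (hballs.and (h.strictMono.tendsto_atTop.eventually ht))).exists
  have hU : MeasurableSet (⋃ i, Metric.closedBall (y i n) (m : ℝ))ᶜ :=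
    (MeasurableSet.iUnion fun i => measurableSet_closedBall).compl
  have hint := (hρ (φ n)).integrable
  have hmassU : η ≤ ∫ z in (⋃ i, Metric.closedBall (y i n) (m : ℝ))ᶜ, ρ (φ n) z := by
    have h1 : ∫ z, ρ (φ n) z ≤ ∫ z, ((⋃ i, Metric.closedBall (y i n) (m : ℝ))ᶜ.indicator
        (ρ (φ n)) z + ∑ i, (Metric.closedBall (y i n) (m : ℝ)).indicator (ρ (φ n)) z) := by
      refine integral_mono hint ((hint.indicator hU).add
        (integrable_finsetSum _ fun i _ => hint.indicator measurableSet_closedBall)) fun z => ?_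
      have hnn : ∀ s : Set 𝔼, 0 ≤ s.indicator (ρ (φ n)) z := fun s =>
        Set.indicator_nonneg (fun z _ => ((hρ (φ n)).mem_Icc z).1) z
      by_cases hz : z ∈ (⋃ i, Metric.closedBall (y i n) (m : ℝ))ᶜ
      · have := Finset.sum_nonneg fun i (_ : i ∈ Finset.univ) =>
          hnn (Metric.closedBall (y i n) (m : ℝ))
        simp only [Set.indicator_of_mem hz]
        linarith
      · rw [Set.notMem_compl_iff, Set.mem_iUnion] at hz
        obtain ⟨i, hi⟩ := hz
        have h1 := Finset.single_le_sum
          (fun i (_ : i ∈ Finset.univ) => hnn (Metric.closedBall (y i n) (m : ℝ)))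
          (Finset.mem_univ i)
        rw [Set.indicator_of_mem hi] at h1
        linarith [hnn (⋃ i, Metric.closedBall (y i n) (m : ℝ))ᶜ]
    rw [integral_add (hint.indicator hU) (integrable_finsetSum _ fun i _ =>
      hint.indicator measurableSet_closedBall), integral_indicator hU,
      integral_finsetSum _ fun i _ => hint.indicator measurableSet_closedBall, hm] at h1
    simp only [integral_indicator measurableSet_closedBall] at h1
    linarith
  exact absurd (densityEigenvalue_le_of_hasPositiveFamily (hρ (φ n)).isWeight
    (hvan _ (hρ _) (hm _) _ hU hmassU hn1)) (not_le.2 hn3)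

/-- The limits of a sequence of densities of unit mass form a collection of densities of at least
unit mass, whose eigenvalue of index `k` is at least the lower limit along the sequence. -/
theorem exists_collection_of_sequence (hN : 1 ≤ N) {k : ℕ} {ρ : ℕ → 𝔼 → ℝ}
    (hρ : ∀ n, IsDensity (ρ n)) (hm : ∀ n, ∫ x, ρ n x = 1) {T : ℝ≥0∞} (hT : 0 < T)
    (hlim : ∀ t : ℝ, ENNReal.ofReal t < T →
      ∀ᶠ n in atTop, ENNReal.ofReal t < densityEigenvalue (ρ n) k) :
    ∃ (j : ℕ) (σ : Fin j → 𝔼 → ℝ) (n : Fin j → ℕ), 0 < j ∧ (∀ i, IsDensity (σ i)) ∧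
      ∑ i, n i = k ∧ (∀ i, T ≤ densityEigenvalue (σ i) (n i)) ∧ 1 ≤ ∑ i, ∫ x, σ i x := by
  classical
  obtain ⟨t₀, -, ht₀, ht₀T⟩ := ENNReal.lt_iff_exists_real_btwn.1 hT
  have ht₀' : 0 < t₀ := ENNReal.ofReal_pos.1 ht₀
  let p : ℕ → Prop := fun j => ∃ (φ : ℕ → ℕ) (y : Fin j → ℕ → 𝔼) (σ : Fin j → 𝔼 → ℝ),
    IsProfileFamily ρ φ y σ
  have hpk : ∀ j, p j → j ≤ k := by
    rintro j ⟨φ, y, σ, h⟩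
    simpa using h.sum_le hρ (hlim t₀ ht₀T) (d := fun _ => 1)
      fun i => (h.isDensity i).hasPositiveFamily_one ht₀'
  have hp0 : p 0 := ⟨id, fun i => i.elim0, fun i => i.elim0, strictMono_id, fun i => i.elim0,
    fun i => i.elim0, fun i => i.elim0⟩
  obtain ⟨j, ⟨φ, y, σ, h⟩, hsucc⟩ : ∃ j, p j ∧ ¬ p (j + 1) := by
    by_contra! hno
    have hall : ∀ j, p j := fun j => Nat.rec hp0 (fun j hj => hno j hj) j
    exact absurd (hpk (k + 1) (hall _)) (by omega)
  have hmass := h.one_le_sum_mass hN hρ hm ht₀' (hlim t₀ ht₀T) hsucc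
  have hj : 0 < j := by
    rcases Nat.eq_zero_or_pos j with h0 | h0
    · have : IsEmpty (Fin j) := by rw [h0]; infer_instance
      simp only [Finset.univ_eq_empty, Finset.sum_empty] at hmass
      linarith
    · exact h0
  -- d i counts eigenvalues of σ i below T, the last of them having index d i − 1. Finitely many
  -- values below T leave room for one real level t < T that serves all profiles.
  have hbelow : ∀ d : Fin j → ℕ, (∀ i, d i ≠ 0 → densityEigenvalue (σ i) (d i - 1) < T) →
      ∑ i, d i ≤ k := by
    intro d hd
    have hsup : (Finset.univ.sup fun i =>
        if d i = 0 then 0 else densityEigenvalue (σ i) (d i - 1)) < T := by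
      refine (Finset.sup_lt_iff hT).2 fun i _ => ?_
      split_ifs with h0
      · exact hT
      · exact hd i h0
    obtain ⟨t, -, ht1, ht2⟩ := ENNReal.lt_iff_exists_real_btwn.1 hsup
    refine h.sum_le hρ (hlim t ht2) fun i => ?_
    by_cases h0 : d i = 0
    · rw [h0]
      exact hasPositiveFamily_zero _ _
    · have h1 := (Finset.le_sup (f := fun i =>
        if d i = 0 then 0 else densityEigenvalue (σ i) (d i - 1)) (Finset.mem_univ i)).trans_lt ht1
      simp only [h0, if_false] at h1
      have h2 := hasPositiveFamily_of_densityEigenvalue_lt (h.isDensity i).isWeight h1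
      rwa [Nat.sub_add_cancel (Nat.pos_of_ne_zero h0)] at h2
  have hex : ∀ i, ∃ n, T ≤ densityEigenvalue (σ i) n := fun i => by
    by_contra! hno
    have := hbelow (fun l => if l = i then k + 1 else 0) fun l hl => by
      have hli : l = i := by
        by_contra hne
        simp [hne] at hl
      rw [hli]
      exact hno _
    simp at this
  let ν : Fin j → ℕ := fun i => Nat.find (hex i)
  have hν : ∑ i, ν i ≤ k := hbelow ν fun i hi =>
    not_le.1 (Nat.find_min (hex i) (Nat.sub_lt (Nat.pos_of_ne_zero hi) one_pos))
  -- The least admissible indices may sum to less than k; the excess goes to one profile, which is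
  -- harmless by monotonicity.
  refine ⟨j, σ, fun i => ν i + if i = ⟨0, hj⟩ then k - ∑ i, ν i else 0, hj, h.isDensity, ?_,
    fun i => (Nat.find_spec (hex i)).trans
      (densityEigenvalue_mono (h.isDensity i).isWeight (Nat.le_add_right _ _)), hmass⟩
  rw [Finset.sum_add_distrib, Finset.sum_ite_eq' Finset.univ, if_pos (Finset.mem_univ _)]
  omega

end Profiles

/-! ### Finiteness of μ*, normalization, and maximizing collections. -/

section Existence

open Filter Topology

variable {N : ℕ}

local notation "𝔼" => EuclideanSpace ℝ (Fin N)

/-! ### Finiteness and normalization -/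

/-- The measure ρ dx is carried by its support, and a finite support would be Lebesgue null as N ≥
1. -/
theorem IsDensity.infinite_setOf_forall_pos (hN : 1 ≤ N) {ρ : 𝔼 → ℝ} (hρ : IsDensity ρ) :
    {x : 𝔼 | ∀ r, 0 < r → 0 < ∫ z in Metric.closedBall x r, ρ z}.Infinite := by
  have : Nonempty (Fin N) := ⟨⟨0, hN⟩⟩
  set ν : Measure 𝔼 := volume.withDensity fun x => ENNReal.ofReal (ρ x) with hν
  have hρ0 : 0 ≤ᵐ[volume] ρ := ae_of_all _ fun x => (hρ.mem_Icc x).1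
  have hball : ∀ s, MeasurableSet s → ν s = ENNReal.ofReal (∫ z in s, ρ z) := fun s hs => by
    rw [hν, withDensity_apply _ hs, ofReal_integral_eq_lintegral_ofReal
      hρ.integrable.integrableOn (ae_restrict_of_ae hρ0)]
  have hsub : ν.support ⊆ {x : 𝔼 | ∀ r, 0 < r → 0 < ∫ z in Metric.closedBall x r, ρ z} := by
    intro x hx r hr
    have h := (Measure.mem_support_iff_forall x).1 hx _ (Metric.closedBall_mem_nhds x hr)
    rw [hball _ measurableSet_closedBall] at h
    exact ENNReal.ofReal_pos.1 h
  refine Set.Infinite.mono hsub fun hfin => ?_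
  have h1 : ν ν.support = 0 := withDensity_absolutelyContinuous _ _ (hfin.measure_zero volume)
  have h2 : ν Set.univ = 0 := by
    rw [← Set.union_compl_self ν.support]
    exact measure_union_null h1 Measure.measure_compl_support
  rw [hball _ MeasurableSet.univ, setIntegral_univ, ENNReal.ofReal_eq_zero] at h2
  exact absurd hρ.mass_pos (not_lt.2 h2)

/-- Small disjoint balls about k+1 points of the support of ρ dx, one per group, give k+1 test
functions; t is the level required by the group lemma. -/
theorem IsDensity.densityEigenvalue_lt_top (hN : 1 ≤ N) {ρ : 𝔼 → ℝ} (hρ : IsDensity ρ) (k : ℕ) :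
    densityEigenvalue ρ k < ⊤ := by
  obtain ⟨C, hC, hgroups⟩ := exists_const_hasPositiveFamily_of_groups N
  have hinf := hρ.infinite_setOf_forall_pos hN
  let p : Fin (k + 1) → 𝔼 := fun i => hinf.natEmbedding _ i
  have hp : ∀ i r, 0 < r → 0 < ∫ z in Metric.closedBall (p i) r, ρ z := fun i =>
    (hinf.natEmbedding _ i).2
  have hinj : Function.Injective p := fun i l h =>
    Fin.ext ((hinf.natEmbedding _).injective (Subtype.ext h))
  have hsmall : ∀ᶠ r : ℝ in 𝓝[>] 0, ∀ i l, i ≠ l → 4 * r < ‖p i - p l‖ := by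
    refine eventually_all.2 fun i => eventually_all.2 fun l => ?_
    by_cases hil : i = l
    · exact Eventually.of_forall fun r h => absurd hil h
    · have h1 : 0 < ‖p i - p l‖ := norm_pos_iff.2 (sub_ne_zero.2 (hinj.ne hil))
      have h2 : Tendsto (fun r : ℝ => 4 * r) (𝓝[>] 0) (𝓝 0) := by
        have : Continuous fun r : ℝ => 4 * r := by fun_prop
        simpa using (this.tendsto 0).mono_left (nhdsWithin_le_nhds (s := Set.Ioi 0))
      filter_upwards [h2.eventually_lt_const h1] with r hr _ using hr
  obtain ⟨r, hr, hr0⟩ := (hsmall.and self_mem_nhdsWithin).exists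
  have hr0' : (0 : ℝ) < r := hr0
  obtain ⟨i₀, -, hi₀⟩ := Finset.exists_min_image Finset.univ
    (fun i => ∫ z in Metric.closedBall (p i) r, ρ z) Finset.univ_nonempty
  set η : ℝ := ∫ z in Metric.closedBall (p i₀) r, ρ z
  have hη : 0 < η := hp i₀ r hr0'
  have hmass := hρ.mass_pos
  set t : ℝ := (C ^ 2 * (∫ x, ρ x) + 1) / (η * r ^ 2) with htdef
  have ht : 0 < t := by positivity
  refine (densityEigenvalue_le_of_hasPositiveFamily hρ.isWeight (hgroups hρ Finset.univ p id hr0'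
    (fun z _ z' _ hne => hr z z' hne) (η := η) (t := t) (fun g => ?_) ht ?_)).trans_lt
    ENNReal.ofReal_lt_top
  · exact (hi₀ g (Finset.mem_univ g)).trans (Finset.single_le_sum
      (f := fun z => ∫ x in Metric.closedBall (p z) r, ρ x) (fun z _ => (hp z r hr0').le)
      (Finset.mem_filter.2 ⟨Finset.mem_univ g, rfl⟩))
  · have : t * η * r ^ 2 = C ^ 2 * (∫ x, ρ x) + 1 := by
      rw [htdef, mul_assoc, div_mul_cancel₀ _ (by positivity)]
    rw [this]
    linarith

theorem IsDensity.exists_unit_mass (hN : 1 ≤ N) {ρ : 𝔼 → ℝ} (hρ : IsDensity ρ) :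
    ∃ σ : 𝔼 → ℝ, IsDensity σ ∧ ∫ x, σ x = 1 ∧ ∀ n, densityEigenvalue σ n =
      ENNReal.ofReal ((∫ x, ρ x) ^ (2 / (N : ℝ))) * densityEigenvalue ρ n := by
  have hm := hρ.mass_pos
  have hN' : (N : ℝ) ≠ 0 := by exact_mod_cast (by omega : N ≠ 0)
  set a : ℝ := (∫ x, ρ x) ^ (1 / (N : ℝ)) with ha
  have ha0 : 0 < a := Real.rpow_pos_of_pos hm _
  have haN : a ^ N = ∫ x, ρ x := by
    rw [ha, ← Real.rpow_natCast, ← Real.rpow_mul hm.le, one_div_mul_cancel hN', Real.rpow_one]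
  have ha2 : a ^ 2 = (∫ x, ρ x) ^ (2 / (N : ℝ)) := by
    rw [ha, ← Real.rpow_natCast, ← Real.rpow_mul hm.le]
    congr 1
    push_cast
    ring
  refine ⟨fun x => ρ (a • x + 0), hρ.comp_smul_add ha0 0, ?_, fun n => ?_⟩
  · rw [integral_comp_smul_add ha0, haN, inv_mul_cancel₀ hm.ne']
  · rw [densityEigenvalue_comp_smul_add hρ.isWeight n ha0, ha2]

theorem exists_isDensity (N : ℕ) : ∃ ρ : EuclideanSpace ℝ (Fin N) → ℝ, IsDensity ρ := by
  have hpos : 0 < volume.real (Metric.closedBall (0 : EuclideanSpace ℝ (Fin N)) 1) :=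
    ENNReal.toReal_pos (Metric.measure_closedBall_pos _ _ one_pos).ne'
      measure_closedBall_lt_top.ne
  refine ⟨(Metric.closedBall 0 1).indicator 1, measurable_one.indicator measurableSet_closedBall,
    fun x => ?_, ?_, ?_⟩
  · by_cases hx : x ∈ Metric.closedBall (0 : EuclideanSpace ℝ (Fin N)) 1 <;> simp [hx]
  · rw [integrable_indicator_iff measurableSet_closedBall]
    exact integrableOn_const measure_closedBall_lt_top.ne
  · rwa [integral_indicator_one measurableSet_closedBall]

/-! ### Maximizing collections -/

/-- At level T there are at least Σ(n_i + 1) = k + j ≥ k + 1 pairs; below T only the pairs with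
index less than n_i can occur, at most k in all. -/
theorem collectionEigenvalue_eq {j : ℕ} (hj : 0 < j) {ρ : Fin j → 𝔼 → ℝ}
    (hρ : ∀ i, IsWeight (ρ i)) {n : Fin j → ℕ} {k : ℕ} (hk : ∑ i, n i = k) {T : ℝ≥0∞}
    (hT : ∀ i, densityEigenvalue (ρ i) (n i) = T) : collectionEigenvalue ρ k = T := by
  have hcard : ∀ m : Fin j → ℕ, Set.encard {p : Fin j × ℕ | p.2 < m p.1} =
      ((∑ i, m i : ℕ) : ℕ∞) := fun m => by
    have h1 : {p : Fin j × ℕ | p.2 < m p.1} = ((Finset.univ.sigma fun i => Finset.range (m i)).map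
        (Equiv.sigmaEquivProd (Fin j) ℕ).toEmbedding : Finset (Fin j × ℕ)) := by
      ext ⟨i, l⟩
      simp
    rw [h1, Set.encard_coe_eq_coe_finsetCard, Finset.card_map, Finset.card_sigma]
    simp
  refine le_antisymm (sInf_le ?_) (le_sInf fun t ht => ?_)
  · have h1 : {p : Fin j × ℕ | p.2 < n p.1 + 1} ⊆
        {p : Fin j × ℕ | densityEigenvalue (ρ p.1) p.2 ≤ T} := fun p hp => by
      rw [Set.mem_ofPred_eq, ← hT p.1]
      exact densityEigenvalue_mono (hρ p.1) (Nat.lt_succ_iff.1 hp)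
    refine le_trans ?_ (Set.encard_le_encard h1)
    rw [hcard fun i => n i + 1, Finset.sum_add_distrib, hk]
    simp only [Finset.sum_const, Finset.card_univ, Fintype.card_fin, smul_eq_mul, mul_one]
    exact_mod_cast Nat.add_le_add_left hj k
  · by_contra! hlt
    have h1 : {p : Fin j × ℕ | densityEigenvalue (ρ p.1) p.2 ≤ t} ⊆
        {p : Fin j × ℕ | p.2 < n p.1} := fun p hp => by
      by_contra hnp
      have h2 := densityEigenvalue_mono (hρ p.1) (not_lt.1 hnp)
      rw [hT] at h2
      exact absurd (h2.trans hp) (not_le.2 hlt)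
    have h2 := le_trans ht (Set.encard_le_encard h1)
    rw [hcard, hk] at h2
    have : k + 1 ≤ k := by exact_mod_cast h2
    omega

theorem sum_mass_le_one (hN : 1 ≤ N) {k : ℕ} (hΛ : 0 < maxEigenvalue N k)
    (hΛ' : maxEigenvalue N k ≠ ⊤) {j : ℕ} (hj : 0 < j) {ρ : Fin j → 𝔼 → ℝ}
    (hρ : ∀ i, IsDensity (ρ i)) {n : Fin j → ℕ} (hk : ∑ i, n i = k)
    (hT : ∀ i, maxEigenvalue N k ≤ densityEigenvalue (ρ i) (n i)) :
    ∑ i, ∫ x, ρ i x ≤ 1 := by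
  by_contra! hlt
  have hN' : (0 : ℝ) < N := by exact_mod_cast hN
  have h1 := mul_le_maxEigenvalue_of_collection hN hj hρ hk hT
  have h2 : 1 < ENNReal.ofReal ((∑ i, ∫ x, ρ i x) ^ (2 / (N : ℝ))) :=
    ENNReal.one_lt_ofReal.2 (Real.one_lt_rpow hlt (by positivity))
  have h3 := ENNReal.mul_lt_mul_left hΛ.ne' hΛ' h2
  rw [one_mul] at h3
  exact absurd h1 (not_le.2 h3)

/-- In a collection of total mass one whose eigenvalues of indices `n i` are at least `μ_k^*`, all
of them are equal to `μ_k^*`: otherwise a dilation would add mass to the collection. -/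
theorem densityEigenvalue_eq_maxEigenvalue (hN : 1 ≤ N) {k : ℕ} (hΛ : 0 < maxEigenvalue N k)
    (hΛ' : maxEigenvalue N k ≠ ⊤) {j : ℕ} (hj : 0 < j) {ρ : Fin j → 𝔼 → ℝ}
    (hρ : ∀ i, IsDensity (ρ i)) {n : Fin j → ℕ} (hk : ∑ i, n i = k)
    (hT : ∀ i, maxEigenvalue N k ≤ densityEigenvalue (ρ i) (n i))
    (hmass : 1 ≤ ∑ i, ∫ x, ρ i x) (i : Fin j) :
    densityEigenvalue (ρ i) (n i) = maxEigenvalue N k := by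
  refine le_antisymm (not_lt.1 fun hlt => ?_) (hT i)
  obtain ⟨s, -, hs1, hs2⟩ := ENNReal.lt_iff_exists_real_btwn.1 hlt
  set l : ℝ := (maxEigenvalue N k).toReal with hl
  have hl0 : 0 < l := ENNReal.toReal_pos hΛ.ne' hΛ'
  have hle : ENNReal.ofReal l = maxEigenvalue N k := ENNReal.ofReal_toReal hΛ'
  have hls : l < s := (ENNReal.ofReal_lt_ofReal_iff_of_nonneg hl0.le).1 (by rwa [hle])
  have hs0 : 0 < s := hl0.trans hls
  -- Dilating by a < 1 multiplies the mass by a^(-N) > 1 and keeps the eigenvalue above a²s = μ*.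
  set a : ℝ := √(l / s) with ha
  have ha0 : 0 < a := Real.sqrt_pos.2 (by positivity)
  have ha2 : a ^ 2 = l / s := Real.sq_sqrt (by positivity)
  have ha1 : a < 1 := by
    rw [← sq_lt_one_iff₀ ha0.le, ha2]
    exact (div_lt_one hs0).2 hls
  set σ : Fin j → 𝔼 → ℝ := Function.update ρ i fun x => ρ i (a • x + 0) with hσ
  have hσi : σ i = fun x => ρ i (a • x + 0) := Function.update_self ..
  have hσl : ∀ l, l ≠ i → σ l = ρ l := fun l hl => Function.update_of_ne hl ..
  have hle1 := sum_mass_le_one hN hΛ hΛ' hj (ρ := σ) (n := n) (fun l => by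
      by_cases h : l = i
      · rw [h, hσi]
        exact (hρ i).comp_smul_add ha0 0
      · rw [hσl l h]
        exact hρ l) hk (fun l => by
      by_cases h : l = i
      · rw [h, hσi, densityEigenvalue_comp_smul_add (hρ i).isWeight _ ha0]
        calc maxEigenvalue N k = ENNReal.ofReal (a ^ 2) * ENNReal.ofReal s := by
              rw [← ENNReal.ofReal_mul (by positivity), ha2, div_mul_cancel₀ _ hs0.ne', hle]
          _ ≤ _ := by gcongr
      · rw [hσl l h]
        exact hT l)
  have hlt1 : ∑ l, ∫ x, ρ l x < ∑ l, ∫ x, σ l x := by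
    refine Finset.sum_lt_sum (fun l _ => ?_) ⟨i, Finset.mem_univ i, ?_⟩
    all_goals
      have hi : ∫ x, ρ i x < ∫ x, σ i x := by
        rw [hσi, integral_comp_smul_add ha0]
        refine lt_mul_of_one_lt_left (hρ i).mass_pos ?_
        exact one_lt_inv_iff₀.2 ⟨by positivity, pow_lt_one₀ ha0.le ha1 (by omega)⟩
    · by_cases h : l = i
      · rw [h]
        exact hi.le
      · rw [hσl l h]
    · exact hi
  linarith

/-- Finiteness of μ* is not assumed. It is deduced from this lemma, because the eigenvalues of each
single limit density are finite. -/
theorem exists_collection_maxEigenvalue_le (hN : 1 ≤ N) {k : ℕ} (hΛ : 0 < maxEigenvalue N k) :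
    ∃ (j : ℕ) (σ : Fin j → 𝔼 → ℝ) (n : Fin j → ℕ), 0 < j ∧ (∀ i, IsDensity (σ i)) ∧
      ∑ i, n i = k ∧ (∀ i, maxEigenvalue N k ≤ densityEigenvalue (σ i) (n i)) ∧
      1 ≤ ∑ i, ∫ x, σ i x := by
  obtain ⟨u, -, hu, hlim⟩ := exists_seq_strictMono_tendsto' hΛ
  have hex : ∀ m, ∃ ρ : 𝔼 → ℝ, IsDensity ρ ∧ ∫ x, ρ x = 1 ∧ u m < densityEigenvalue ρ k := by
    intro m
    have h := (hu m).2
    unfold maxEigenvalue at h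
    simp only [lt_iSup_iff] at h
    obtain ⟨ρ, hρ, hlt⟩ := h
    obtain ⟨σ, hσ, hσ1, hσe⟩ := hρ.exists_unit_mass hN
    exact ⟨σ, hσ, hσ1, by rwa [hσe]⟩
  choose ρ hρ hρ1 hρu using hex
  refine exists_collection_of_sequence hN hρ hρ1 hΛ fun t ht => ?_
  filter_upwards [hlim.eventually_const_lt ht] with m hm
  exact hm.trans (hρu m)

theorem maxEigenvalue_lt_top (hN : 1 ≤ N) (k : ℕ) : maxEigenvalue N k < ⊤ := by
  rcases eq_or_ne (maxEigenvalue N k) 0 with h0 | h0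
  · rw [h0]
    exact ENNReal.zero_lt_top
  · obtain ⟨j, σ, n, hj, hσ, -, hle, -⟩ :=
      exists_collection_maxEigenvalue_le hN (pos_iff_ne_zero.2 h0)
    exact (hle ⟨0, hj⟩).trans_lt ((hσ _).densityEigenvalue_lt_top hN _)

end Existence

theorem theorem1 (N k : ℕ) (hN : 1 ≤ N) (hk : 1 ≤ k) :
    ∃ (j : ℕ) (ρ : Fin j → EuclideanSpace ℝ (Fin N) → ℝ) (n : Fin j → ℕ),
      j ≤ k ∧
      (∀ i, IsDensity (ρ i)) ∧
      (∑ i, ∫ x, ρ i x) = 1 ∧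
      collectionEigenvalue ρ k = maxEigenvalue N k ∧
      (∑ i, n i) = k ∧
      ∀ i, maxEigenvalue N k = densityEigenvalue (ρ i) (n i) := by
  -- If μ* = 0, every density of unit mass is a maximizer by itself.
  rcases eq_or_ne (maxEigenvalue N k) 0 with h0 | h0
  · obtain ⟨ρ, hρ⟩ := exists_isDensity N
    obtain ⟨σ, hσ, hσ1, -⟩ := hρ.exists_unit_mass hN
    have hz : densityEigenvalue σ k = maxEigenvalue N k := by
      have h := mul_densityEigenvalue_le_maxEigenvalue hσ k
      rw [hσ1, Real.one_rpow, ENNReal.ofReal_one, one_mul, h0] at h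
      rw [h0]
      exact le_antisymm h bot_le
    exact ⟨1, fun _ => σ, fun _ => k, hk, fun _ => hσ, by simpa using hσ1,
      collectionEigenvalue_eq one_pos (fun _ => hσ.isWeight) (by simp) fun _ => hz, by simp,
      fun _ => hz.symm⟩
  · have hΛ : 0 < maxEigenvalue N k := pos_iff_ne_zero.2 h0
    have hΛ' := (maxEigenvalue_lt_top hN k).ne
    obtain ⟨j, σ, n, hj, hσ, hn, hle, hmass⟩ := exists_collection_maxEigenvalue_le hN hΛ
    have heq := densityEigenvalue_eq_maxEigenvalue hN hΛ hΛ' hj hσ hn hle hmass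
    -- Since μ_0 = 0 < μ*, every index is at least 1, which bounds the number of densities by k.
    have hn1 : ∀ i, 1 ≤ n i := fun i => Nat.one_le_iff_ne_zero.2 fun hni => by
      have := heq i
      rw [hni, (hσ i).densityEigenvalue_zero] at this
      exact h0 this.symm
    refine ⟨j, σ, n, ?_, hσ, le_antisymm (sum_mass_le_one hN hΛ hΛ' hj hσ hn hle) hmass,
      collectionEigenvalue_eq hj (fun i => (hσ i).isWeight) hn heq, hn, fun i => (heq i).symm⟩
    rw [← hn]
    simpa using Finset.sum_le_sum fun i (_ : i ∈ Finset.univ) => hn1 i
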